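/- Let $F$ be a field and let $A$ be a central division algebra over $F$ of degree $4$ (that is, $\dim_F A = 16$) and exponent $2$ (that is, the class of $A$ in the Brauer group of $F$ has order $2$). An element $v \in A$ is called square-central if $v \notin F$ and $v^2 \in F^\times$; if $\operatorname{char}(F)=2$, it is called Artin-Schreier if $v \notin F$ and $v^2+v \in F$. Let $x, x' \in A$ be commuting elements with $F[x] \neq F[x']$. If $\operatorname{char}(F) = 2$, assume that $x$ is either Artin-Schreier or square-central and that $x'$ is Artin-Schreier. If $\operatorname{char}(F) \neq 2$, assume that $x$ and $x'$ are both square-central. Then there are quaternion $F$-subalgebras $Q_1, Q_2 \subseteq A$ with $x \in Q_1$ and $x' \in Q_2$ such that $A = Q_1 \otimes_F Q_2$, i.e. multiplication in $A$ induces an isomorphism of $F$-algebras $Q_1 \otimes_F Q_2 \to A$. -/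

import Mathlib

open scoped TensorProduct

/-- `A` is split: it is isomorphic to a full matrix algebra over `F`. -/
def IsSplitAlgebra (F A : Type*) [Field F] [Ring A] [Algebra F A] : Prop :=
  ∃ n : ℕ, n ≠ 0 ∧ Nonempty (A ≃ₐ[F] Matrix (Fin n) (Fin n) F)

/-- `A` has exponent 2: the smallest `m > 0` for which the `m`-fold tensor power of `A` over `F`
is split (the order of the Brauer class of `A`) is `m = 2`. -/
def HasExponentTwo (F A : Type*) [Field F] [Ring A] [Algebra F A] : Prop :=
  ¬ IsSplitAlgebra F A ∧ IsSplitAlgebra F (A ⊗[F] A)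

/-- `A` is a central division algebra over `F` of degree `n`, that is, of dimension `n ^ 2`. -/
structure IsCentralDivisionAlgebraOfDegree (F A : Type*) [Field F] [DivisionRing A] [Algebra F A]
    (n : ℕ) : Prop where
  central : Algebra.IsCentral F A
  finite : FiniteDimensional F A
  finrank_eq : Module.finrank F A = n ^ 2

/-- `Q` is a quaternion algebra over `F`: it is isomorphic to `[α, β)`, generated by `i, j` with
`i ^ 2 + i = α`, `j ^ 2 = β`, `j * i * j⁻¹ = i + 1`, where `β ≠ 0`, if `char F = 2`, and to
`(α, β)`, generated by `i, j` with `i ^ 2 = α`, `j ^ 2 = β`, `j * i * j⁻¹ = - i`, where `α, β ≠ 0`,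
if `char F ≠ 2`.  (In `QuaternionAlgebra F a b c` the relations are `i ^ 2 = a + b * i`,
`j ^ 2 = c` and `j * i = b * j - i * j`.) -/
def IsQuaternionAlgebra (F Q : Type*) [Field F] [Ring Q] [Algebra F Q] : Prop :=
  (ringChar F = 2 ∧ ∃ α β : F, β ≠ 0 ∧ Nonempty (Q ≃ₐ[F] QuaternionAlgebra F α 1 β)) ∨
  (ringChar F ≠ 2 ∧ ∃ α β : F, α ≠ 0 ∧ β ≠ 0 ∧ Nonempty (Q ≃ₐ[F] QuaternionAlgebra F α 0 β))

/-- `v` is square-central: it is noncentral and `v ^ 2 ∈ Fˣ`. -/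
def IsSquareCentral (F : Type*) {A : Type*} [Field F] [Ring A] [Algebra F A] (v : A) : Prop :=
  v ∉ Subalgebra.center F A ∧ ∃ c : F, c ≠ 0 ∧ v ^ 2 = algebraMap F A c

/-- `v` is Artin-Schreier (used in characteristic 2): it is noncentral and `v ^ 2 + v ∈ F`. -/
def IsArtinSchreier (F : Type*) {A : Type*} [Field F] [Ring A] [Algebra F A] (v : A) : Prop :=
  v ∉ Subalgebra.center F A ∧ ∃ c : F, v ^ 2 + v = algebraMap F A c

/-- `A = Q₁ ⊗ Q₂` for subalgebras `Q₁, Q₂` of `A`: multiplication in `A` induces an isomorphism of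
`F`-algebras from `Q₁ ⊗ Q₂` to `A`. -/
def IsInternalTensorProduct {F A : Type*} [Field F] [Ring A] [Algebra F A]
    (Q₁ Q₂ : Subalgebra F A) : Prop :=
  ∃ e : (Q₁ ⊗[F] Q₂) ≃ₐ[F] A, ∀ (a : Q₁) (b : Q₂), e (a ⊗ₜ[F] b) = (a : A) * (b : A)

/-!
Write `p` for `x'`. It is a root of a separable polynomial `X ^ 2 - t X + n` over `F`, with
conjugate `t - p`: take `t = 0` away from characteristic two and `t = -1` in characteristic two.
It suffices to find `y ≠ 0` that commutes with `x`, conjugates `p` to `t - p`, and has `y ^ 2 ∈ F`.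
Then `p` and `y` generate a quaternion algebra `Q₂`, its centralizer `Q₁` contains `x`, and
`A = Q₁ ⊗ Q₂` by a dimension count (`quaternion_decomposition`).

Let `B` be the centralizer of `p`. It is a quaternion algebra over its center `L = F + F p`
(`spansOverCenter_centralizer`). Since `A ⊗ A` is split, `A` has an anti-homomorphism `s` over `F`
(`exists_isAntiHom_of_isSplitAlgebra`). After composition with inner automorphisms, `s` fixes `p`
and restricts to the canonical involution of `B` (`exists_isCanonicalOn`). Only the Skolem–Noether
theorem for quadratic elements is needed for this, and it has a direct proof
(`exists_ne_zero_mul_eq_mul`).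

Let `u` conjugate `p` to `t - p`. The canonical involution of `B` commutes with conjugation by `u`,
because it is determined by its traces and norms (`IsCanonicalOn.map_conj`). It follows that
`s u * u` lies in `L`. Elements of `L` are fixed by `s`, so `s (s u) = u`. The element `u` may be
chosen to commute with `x` (`exists_conjugator_commute`; this uses `x ∉ L`, which is the hypothesis
`F[x] ≠ F[x']`). Then `y = u + s u`, or `y = u` if this sum vanishes, satisfies `s y = ± y`. Hence
`y ^ 2 = ± s y * y` lies in `L` and commutes with `y`, so it is central in `A`
(`IsCanonicalOn.exists_square_central`). The argument does not need `F[x]` to be separable over `F`.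
-/

/-! ### Quadratic elements and quaternion generators in a division ring -/

section DivisionRing

variable {D : Type*} [DivisionRing D]

/-- The Skolem–Noether theorem for two roots `p`, `q` of the same polynomial `X ^ 2 - t X + n`:
for every `z` the element `z p - (t - q) z` intertwines `p` and `q`, and these elements do not all
vanish. -/
theorem exists_ne_zero_mul_eq_mul {t n p q : D} (ht : ∀ d, d * t = t * d) (hn : ∀ d, d * n = n * d)
    (hp : p * p = t * p - n) (hq : q * q = t * q - n) (hqc : ∃ d, d * q ≠ q * d) :
    ∃ w, w ≠ 0 ∧ w * p = q * w := by
  have key : ∀ z, (z * p - (t - q) * z) * p = q * (z * p - (t - q) * z) := by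
    intro z
    linear_combination (norm := noncomm_ring) z * hp - hq * z + ht z * p - hn z + ht q * z
  by_contra! hall
  have hz : ∀ z, z * p - (t - q) * z = 0 := fun z => by
    by_contra h
    exact hall _ h (key z)
  obtain ⟨d, hd⟩ := hqc
  have h1 : p = t - q := by simpa [sub_eq_zero] using hz 1
  apply hd
  have h2 := hz d
  rw [h1] at h2
  linear_combination (norm := noncomm_ring) ht d - h2

/-- Commutators with a quadratic element `p` conjugate `p` to `t - p`. -/
theorem mul_conj_eq_mul_sub {t n p : D} (ht : ∀ d, d * t = t * d) (hn : ∀ d, d * n = n * d)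
    (hp : p * p = t * p - n) (z : D) :
    (p * z - z * p) * p = (t - p) * (p * z - z * p) := by
  linear_combination (norm := noncomm_ring) hp * z - z * hp - ht z * p + hn z

/-- `i` and `j` are standard quaternion generators of `D` over its center: `i` is a root of
`X ^ 2 - t X + n`, conjugation by `j` sends `i` to `t - i`, and `j ^ 2 = δ`.  The trace `t` is
normalized to `0` away from characteristic two and to `1` in characteristic two. -/
structure IsQuaternionFrame (i j t n δ : D) : Prop where
  t_eq : t = 0 ∧ (2 : D) ≠ 0 ∨ t = 1 ∧ (2 : D) = 0
  n_central : ∀ d, d * n = n * d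
  δ_central : ∀ d, d * δ = δ * d
  i_mul_i : i * i = t * i - n
  j_mul_i : j * i = (t - i) * j
  j_mul_j : j * j = δ
  not_comm : i * j ≠ j * i

/-- For noncommuting `b`, `c` the elements `1, b, c, b c` span `D` over its center.  This is how
`D` having dimension at most four over its center is encoded, without making `D` an algebra over a
field isomorphic to the center. -/
def SpansOverCenter (D : Type*) [DivisionRing D] : Prop :=
  ∀ b c : D, b * c ≠ c * b → ∀ d, ∃ z₁ ∈ Subring.center D, ∃ z₂ ∈ Subring.center D,
    ∃ z₃ ∈ Subring.center D, ∃ z₄ ∈ Subring.center D, d = z₁ + z₂ * b + (z₃ + z₄ * b) * c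

theorem SpansOverCenter.mul_self {D : Type*} [DivisionRing D] (H : SpansOverCenter D) {b c : D}
    (hbc : b * c ≠ c * b) :
    ∃ t ∈ Subring.center D, ∃ n ∈ Subring.center D, b * b = t * b - n := by
  obtain ⟨z₁, h₁, z₂, h₂, z₃, h₃, z₄, h₄, h⟩ := H b c hbc (b * b)
  rw [Subring.mem_center_iff] at h₁ h₂ h₃ h₄
  have h0 : (z₃ + z₄ * b) * (b * c - c * b) = 0 := by
    have := congrArg (fun d => b * d - d * b) h
    linear_combination (norm := noncomm_ring) h * b - b * h - h₁ b - h₂ b * b - h₃ b * c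
      - h₄ b * b * c
  have h0' : z₃ + z₄ * b = 0 := (mul_eq_zero.1 h0).resolve_right (sub_ne_zero.2 hbc)
  refine ⟨z₂, Subring.mem_center_iff.2 h₂, -z₁, neg_mem (Subring.mem_center_iff.2 h₁), ?_⟩
  rw [h, h0']
  noncomm_ring

/-- An element that commutes with two noncommuting elements is central. -/
theorem SpansOverCenter.mem_center_of_commute {D : Type*} [DivisionRing D] (H : SpansOverCenter D)
    {i j a : D} (hij : i * j ≠ j * i) (hai : a * i = i * a) (haj : a * j = j * a) :
    a ∈ Subring.center D := by
  rw [Subring.mem_center_iff]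
  intro d
  obtain ⟨z₁, h₁, z₂, h₂, z₃, h₃, z₄, h₄, rfl⟩ := H i j hij d
  rw [Subring.mem_center_iff] at h₁ h₂ h₃ h₄
  linear_combination (norm := noncomm_ring) -h₁ a - h₂ a * i - z₂ * hai - h₃ a * j - z₃ * haj
    - h₄ a * i * j - z₄ * hai * j - z₄ * i * haj

/-- A noncentral separable element of normalized trace: away from characteristic two, complete
the square; in characteristic two, an element of nonzero trace can be scaled, and an element `b` of
trace zero yields `i` with `b i b⁻¹ = i + 1`, which has trace one. -/
theorem SpansOverCenter.exists_generator (H : SpansOverCenter D) (hD : ∃ b c : D, b * c ≠ c * b) :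
    ∃ i t n : D, (t = 0 ∧ (2 : D) ≠ 0 ∨ t = 1 ∧ (2 : D) = 0) ∧ n ∈ Subring.center D ∧
      i * i = t * i - n ∧ ∃ z, i * z ≠ z * i := by
  obtain ⟨b, c, hbc⟩ := hD
  obtain ⟨t, ht, n, hn, hb⟩ := H.mul_self hbc
  have ht' := Subring.mem_center_iff.1 ht
  by_cases h2 : (2 : D) = 0
  · have hadd : ∀ d : D, d + d = 0 := fun d => by rw [← two_mul, h2, zero_mul]
    by_cases ht0 : t = 0
    · subst ht0
      have hw0 : b * c - c * b ≠ 0 := sub_ne_zero.2 hbc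
      obtain ⟨w, hw⟩ : ∃ w, w = b * c - c * b := ⟨_, rfl⟩
      rw [← hw] at hw0
      -- `w` commutes with `b` because `b ^ 2` is central.
      have hn' := Subring.mem_center_iff.1 hn
      have hwb : w * b = b * w := by
        have h1 := hadd (b * c * b)
        rw [hw]
        linear_combination (norm := noncomm_ring) h1 - hb * c - c * hb + hn' c + hadd (n * c)
      have hwb' : w⁻¹ * b = b * w⁻¹ :=
        ((show Commute w b from hwb).inv_left₀).eq
      have hbi : b * (w⁻¹ * c * b) = (w⁻¹ * c * b) * b + b := by
        have : w⁻¹ * (b * c - c * b) = 1 := by rw [← hw]; exact inv_mul_cancel₀ hw0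
        linear_combination (norm := noncomm_ring) this * b - hwb' * c * b
      obtain ⟨i, hi⟩ : ∃ i, i = w⁻¹ * c * b := ⟨_, rfl⟩
      rw [← hi] at hbi
      have hb0 : b ≠ 0 := by rintro rfl; simp at hbc
      have hib : i * b ≠ b * i := fun h => hb0 (by simpa [h] using hbi)
      obtain ⟨s, hs, m, hm, hii⟩ := H.mul_self hib
      have hs' := Subring.mem_center_iff.1 hs
      have hm' := Subring.mem_center_iff.1 hm
      -- Conjugation by `b` sends `i` to `i + 1`, so the trace `s` of `i` is `1`.
      have hs1 : (s - 1) * b = 0 := by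
        linear_combination (norm := noncomm_ring) b * hii - hii * b - hbi * i - i * hbi
          + hs' b * i + s * hbi - hm' b - hadd (i * b) - hbi + hadd (s * b) - hadd b
      have hs1' : s = 1 := sub_eq_zero.1 ((mul_eq_zero.1 hs1).resolve_right hb0)
      exact ⟨i, s, m, Or.inr ⟨hs1', h2⟩, hm, hii, b, hib⟩
    · have htb : t⁻¹ * b = b * t⁻¹ := ((show Commute t b from (ht' b).symm).inv_left₀).eq
      have hti := Subring.mem_center_iff.1 (Set.inv_mem_center ht : t⁻¹ ∈ Subring.center D)
      have htt : t⁻¹ * t = 1 := inv_mul_cancel₀ ht0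
      refine ⟨t⁻¹ * b, 1, t⁻¹ * t⁻¹ * n, Or.inr ⟨rfl, h2⟩, ?_, ?_, c, ?_⟩
      · exact mul_mem (mul_mem (Set.inv_mem_center ht) (Set.inv_mem_center ht)) hn
      · linear_combination (norm := noncomm_ring) -t⁻¹ * htb * b + t⁻¹ * t⁻¹ * hb + t⁻¹ * htt * b
      · intro h
        apply hbc
        have := congrArg (t * ·) h
        simp only [← mul_assoc] at this
        rw [mul_inv_cancel₀ ht0, one_mul, mul_assoc t c, hti c, ← mul_assoc t,
          mul_inv_cancel₀ ht0, one_mul] at this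
        exact this
  · have h2c : (2 : D)⁻¹ ∈ Subring.center D := Set.inv_mem_center (natCast_mem (Subring.center D) 2)
    have h2c' := Subring.mem_center_iff.1 h2c
    have h22 : (2 : D)⁻¹ * 2 = 1 := inv_mul_cancel₀ h2
    have htc : t * 2⁻¹ ∈ Subring.center D := mul_mem ht h2c
    obtain ⟨s, hs⟩ : ∃ s, s = t * 2⁻¹ := ⟨_, rfl⟩
    rw [← hs] at htc
    have hs' := Subring.mem_center_iff.1 htc
    have hst : s + s = t := by
      rw [← mul_two, hs, mul_assoc, h22, mul_one]
    refine ⟨b - s, 0, n - s * s, Or.inl ⟨rfl, h2⟩, sub_mem hn (mul_mem htc htc), ?_, c, ?_⟩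
    · linear_combination (norm := noncomm_ring) hb - hs' b - hst * b
    · intro h
      apply hbc
      linear_combination (norm := noncomm_ring) h - hs' c

theorem SpansOverCenter.exists_isQuaternionFrame (H : SpansOverCenter D)
    (hD : ∃ b c : D, b * c ≠ c * b) : ∃ i j t n δ : D, IsQuaternionFrame i j t n δ := by
  obtain ⟨i, t, n, ht, hn, hi, z, hz⟩ := H.exists_generator hD
  have ht' : ∀ d, d * t = t * d := by
    rcases ht with ⟨rfl, _⟩ | ⟨rfl, _⟩ <;> simp
  have hn' := Subring.mem_center_iff.1 hn
  have hj := mul_conj_eq_mul_sub ht' hn' hi z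
  have hj0 : i * z - z * i ≠ 0 := sub_ne_zero.2 hz
  obtain ⟨j, hjdef⟩ : ∃ j, j = i * z - z * i := ⟨_, rfl⟩
  rw [← hjdef] at hj hj0
  have hij : i * j ≠ j * i := by
    intro h
    rw [hj, ← sub_eq_zero, ← sub_mul] at h
    have h0 := (mul_eq_zero.1 h).resolve_right hj0
    rcases ht with ⟨rfl, h2⟩ | ⟨rfl, h2⟩
    · have : 2 * i = 0 := by linear_combination (norm := noncomm_ring) h0
      have hi0 := (mul_eq_zero.1 this).resolve_left h2
      simp [hi0] at hz
    · have : (2 : D) * i = 1 := by linear_combination (norm := noncomm_ring) h0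
      rw [h2, zero_mul] at this
      exact zero_ne_one this
  refine ⟨i, j, t, n, j * j, ht, hn', ?_, hi, hj, rfl, hij⟩
  refine Subring.mem_center_iff.1 (H.mem_center_of_commute hij ?_ (mul_assoc j j j))
  linear_combination (norm := noncomm_ring) j * hj + ht' j * j - hj * j

end DivisionRing

/-! ### Recognizing quaternion algebras by their dimension -/

section Algebra

variable {F D : Type*} [Field F] [DivisionRing D] [Algebra F D]

theorem linearIndependent_center {b c : D} (hbc : b * c ≠ c * b) {z₁ z₂ z₃ z₄ : D}
    (h₁ : z₁ ∈ Subring.center D) (h₂ : z₂ ∈ Subring.center D) (h₃ : z₃ ∈ Subring.center D)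
    (h₄ : z₄ ∈ Subring.center D) (h : z₁ + z₂ * b + (z₃ + z₄ * b) * c = 0) :
    z₁ = 0 ∧ z₂ = 0 ∧ z₃ = 0 ∧ z₄ = 0 := by
  have aux : ∀ {u v : D}, u ∈ Subring.center D → v ∈ Subring.center D → u + v * b = 0 →
      u = 0 ∧ v = 0 := by
    intro u v hu hv huv
    rw [Subring.mem_center_iff] at hu hv
    have : v * (b * c - c * b) = 0 := by
      linear_combination (norm := noncomm_ring) huv * c - c * huv + hu c + hv c * b
    have hv0 := (mul_eq_zero.1 this).resolve_right (sub_ne_zero.2 hbc)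
    exact ⟨by simpa [hv0] using huv, hv0⟩
  have h34 : (z₃ + z₄ * b) * (b * c - c * b) = 0 := by
    rw [Subring.mem_center_iff] at h₁ h₂ h₃ h₄
    linear_combination (norm := noncomm_ring) b * h - h * b - h₁ b - h₂ b * b - h₃ b * c
      - h₄ b * b * c
  have h34' := (mul_eq_zero.1 h34).resolve_right (sub_ne_zero.2 hbc)
  rw [h34', zero_mul, add_zero] at h
  exact ⟨(aux h₁ h₂ h).1, (aux h₁ h₂ h).2, (aux h₃ h₄ h34').1, (aux h₃ h₄ h34').2⟩

/-- The linear map `((z₁, z₂), (z₃, z₄)) ↦ z₁ + z₂ b + (z₃ + z₄ b) c` on quadruples of central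
elements. -/
def centerCombination (F : Type*) {D : Type*} [Field F] [DivisionRing D] [Algebra F D] (b c : D) :
    (Subalgebra.center F D × Subalgebra.center F D) ×
      (Subalgebra.center F D × Subalgebra.center F D) →ₗ[F] D where
  toFun z := z.1.1 + z.1.2 * b + (z.2.1 + z.2.2 * b) * c
  map_add' := by intros; simp; noncomm_ring
  map_smul' := by intros; simp [smul_add, add_mul]

theorem centerCombination_injective {b c : D} (hbc : b * c ≠ c * b) :
    Function.Injective (centerCombination F b c) := by
  rw [← LinearMap.ker_eq_bot, LinearMap.ker_eq_bot']
  rintro ⟨⟨⟨z₁, h₁⟩, ⟨z₂, h₂⟩⟩, ⟨⟨z₃, h₃⟩, ⟨z₄, h₄⟩⟩⟩ h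
  have := linearIndependent_center hbc h₁ h₂ h₃ h₄ h
  simp only [this.1, this.2.1, this.2.2.1, this.2.2.2]
  rfl

theorem four_mul_finrank_center_le [FiniteDimensional F D] (hD : ∃ b c : D, b * c ≠ c * b) :
    4 * Module.finrank F (Subalgebra.center F D) ≤ Module.finrank F D := by
  obtain ⟨b, c, hbc⟩ := hD
  have := LinearMap.finrank_le_finrank_of_injective (centerCombination_injective (F := F) hbc)
  simp only [Module.finrank_prod] at this
  omega

/-- The elements `1, b, c, b c` are always independent over the center, so they span as soon as
the dimension permits. -/
theorem spansOverCenter_of_finrank_le [FiniteDimensional F D]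
    (hle : Module.finrank F D ≤ 4 * Module.finrank F (Subalgebra.center F D)) :
    SpansOverCenter D := by
  intro b c hbc d
  have hinj := centerCombination_injective (F := F) hbc
  have hsurj := (LinearMap.injective_iff_surjective_of_finrank_eq_finrank (by
    have := four_mul_finrank_center_le (F := F) ⟨b, c, hbc⟩
    simp only [Module.finrank_prod]
    omega)).1 hinj
  obtain ⟨⟨⟨⟨z₁, h₁⟩, ⟨z₂, h₂⟩⟩, ⟨⟨z₃, h₃⟩, ⟨z₄, h₄⟩⟩⟩, h⟩ := hsurj d
  exact ⟨z₁, h₁, z₂, h₂, z₃, h₃, z₄, h₄, h.symm⟩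

theorem ringChar_eq_two_iff : ringChar F = 2 ↔ (2 : D) = 0 := by
  rw [← map_ofNat (algebraMap F D) 2, map_eq_zero, ← Nat.cast_two (R := F), ringChar.spec,
    Nat.dvd_prime Nat.prime_two]
  exact ⟨Or.inr, fun h => h.resolve_left CharP.ringChar_ne_one⟩

/-- A noncommutative division algebra of dimension four with center `F` is a quaternion algebra. -/
theorem isQuaternionAlgebra_of_finrank_eq_four [FiniteDimensional F D]
    (hfr : Module.finrank F D = 4)
    (hcen : ∀ z : D, (∀ d, d * z = z * d) → ∃ c, z = algebraMap F D c)
    (hD : ∃ b c : D, b * c ≠ c * b) : IsQuaternionAlgebra F D := by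
  have H : SpansOverCenter D := by
    apply spansOverCenter_of_finrank_le (F := F)
    have : 0 < Module.finrank F (Subalgebra.center F D) := Module.finrank_pos
    omega
  obtain ⟨i, j, t, n, δ, h⟩ := H.exists_isQuaternionFrame hD
  obtain ⟨n', hn'⟩ := hcen n h.n_central
  obtain ⟨δ', hδ'⟩ := hcen δ h.δ_central
  have key : ∀ t' : F, algebraMap F D t' = t →
      Nonempty (D ≃ₐ[F] QuaternionAlgebra F (-n') t' δ') := by
    intro t' ht'
    let B : QuaternionAlgebra.Basis D (-n') t' δ' :=
      { i := i, j := j, k := i * j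
        i_mul_i := by
          rw [h.i_mul_i, ← ht', hn', Algebra.smul_def, Algebra.smul_def, map_neg]; noncomm_ring
        j_mul_j := by rw [h.j_mul_j, hδ', Algebra.smul_def, mul_one]
        i_mul_j := rfl
        j_mul_i := by rw [h.j_mul_i, Algebra.smul_def, ht', sub_mul] }
    have hsurj : Function.Surjective B.liftHom := by
      intro d
      obtain ⟨z₁, h₁, z₂, h₂, z₃, h₃, z₄, h₄, rfl⟩ := H i j h.not_comm d
      obtain ⟨c₁, rfl⟩ := hcen z₁ (Subring.mem_center_iff.1 h₁)
      obtain ⟨c₂, rfl⟩ := hcen z₂ (Subring.mem_center_iff.1 h₂)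
      obtain ⟨c₃, rfl⟩ := hcen z₃ (Subring.mem_center_iff.1 h₃)
      obtain ⟨c₄, rfl⟩ := hcen z₄ (Subring.mem_center_iff.1 h₄)
      refine ⟨⟨c₁, c₂, c₃, c₄⟩, ?_⟩
      change B.lift _ = _
      simp only [QuaternionAlgebra.Basis.lift, Algebra.smul_def, B]
      noncomm_ring
    have hinj : Function.Injective B.liftHom :=
      (LinearMap.injective_iff_surjective_of_finrank_eq_finrank (f := B.liftHom.toLinearMap)
        (by rw [QuaternionAlgebra.finrank_eq_four, hfr])).2 hsurj
    exact ⟨(AlgEquiv.ofBijective B.liftHom ⟨hinj, hsurj⟩).symm⟩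
  have hj0 : j ≠ 0 := by
    rintro rfl
    exact h.not_comm (by simp)
  have hδ0 : δ' ≠ 0 := by
    rintro rfl
    rw [map_zero] at hδ'
    have := h.j_mul_j
    rw [hδ', mul_self_eq_zero] at this
    exact hj0 this
  have h2 : ringChar F = 2 ↔ (2 : D) = 0 := ringChar_eq_two_iff
  rcases h.t_eq with ⟨ht, hne⟩ | ⟨ht, heq⟩
  · refine Or.inr ⟨fun hc => hne (h2.1 hc), -n', δ', ?_, hδ0, key 0 (by simp [ht])⟩
    intro hn0
    have := h.i_mul_i
    rw [hn', neg_eq_zero.1 hn0, ht, map_zero, zero_mul, sub_zero, mul_self_eq_zero] at this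
    exact h.not_comm (by rw [this, zero_mul, mul_zero])
  · exact Or.inl ⟨h2.2 heq, -n', δ', hδ0, key 1 (by simp [ht])⟩

end Algebra

/-! ### Anti-homomorphisms and the canonical involution of a quaternion algebra -/

section AntiHom

variable {D : Type*} [DivisionRing D]

/-- `s` is a unital ring anti-homomorphism from `D` to itself. -/
structure IsAntiHom (s : D → D) : Prop where
  map_one : s 1 = 1
  map_add : ∀ a b, s (a + b) = s a + s b
  map_mul : ∀ a b, s (a * b) = s b * s a

namespace IsAntiHom

variable {s : D → D}

theorem map_zero (hs : IsAntiHom s) : s 0 = 0 := by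
  simpa using hs.map_add 0 0

theorem map_neg (hs : IsAntiHom s) (a : D) : s (-a) = -s a := by
  rw [eq_neg_iff_add_eq_zero, ← hs.map_add, neg_add_cancel, hs.map_zero]

theorem map_sub (hs : IsAntiHom s) (a b : D) : s (a - b) = s a - s b := by
  rw [sub_eq_add_neg, hs.map_add, hs.map_neg, ← sub_eq_add_neg]

theorem conj (hs : IsAntiHom s) {w : D} (hw : w ≠ 0) : IsAntiHom fun d => w * s d * w⁻¹ where
  map_one := by rw [hs.map_one, mul_one, mul_inv_cancel₀ hw]
  map_add a b := by rw [hs.map_add, mul_add, add_mul]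
  map_mul a b := by
    have : w⁻¹ * w = 1 := inv_mul_cancel₀ hw
    rw [hs.map_mul]
    linear_combination (norm := noncomm_ring) -w * s b * this * s a * w⁻¹

end IsAntiHom

theorem commute_add_mul_of_mem_center {a i z₁ z₂ : D} (h₁ : z₁ ∈ Subring.center D)
    (h₂ : z₂ ∈ Subring.center D) (hai : Commute a i) : Commute a (z₁ + z₂ * i) :=
  Commute.add_right (Subring.mem_center_iff.1 h₁ a)
    (Commute.mul_right (Subring.mem_center_iff.1 h₂ a) hai)

/-- The norm of an element of the quadratic extension generated by `i` is central. -/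
theorem mul_conj_mem_center {i t n z₁ z₂ : D} (ht : t ∈ Subring.center D)
    (hn : n ∈ Subring.center D) (hi : i * i = t * i - n)
    (h₁ : z₁ ∈ Subring.center D) (h₂ : z₂ ∈ Subring.center D) :
    (z₁ + z₂ * i) * (z₁ + z₂ * (t - i)) ∈ Subring.center D := by
  have h₁' := Subring.mem_center_iff.1 h₁
  have h₂' := Subring.mem_center_iff.1 h₂
  have ht' := Subring.mem_center_iff.1 ht
  have : (z₁ + z₂ * i) * (z₁ + z₂ * (t - i)) = z₁ * z₁ + z₁ * z₂ * t + z₂ * z₂ * n := by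
    linear_combination (norm := noncomm_ring) z₂ * h₁' i + z₂ * h₂' i * (t - i) - z₂ * z₂ * hi
      + z₂ * z₂ * ht' i - h₂' z₁ * i
  rw [this]
  exact add_mem (add_mem (mul_mem h₁ h₁) (mul_mem (mul_mem h₁ h₂) ht)) (mul_mem (mul_mem h₂ h₂) hn)

theorem IsQuaternionFrame.t_mem_center {i j t n δ : D} (h : IsQuaternionFrame i j t n δ) :
    t ∈ Subring.center D := by
  rcases h.t_eq with ⟨h, _⟩ | ⟨h, _⟩ <;> rw [h]
  · exact zero_mem _
  · exact one_mem _

/-- An anti-homomorphism that is the identity on the center and sends `i` to `t - i` and `j` to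
`-j` is the canonical involution: traces and norms are central. -/
theorem IsAntiHom.canonical_of_frame {s : D → D} (hs : IsAntiHom s) (H : SpansOverCenter D)
    (hcen : ∀ z ∈ Subring.center D, s z = z) {i j t n δ : D} (h : IsQuaternionFrame i j t n δ)
    (hi : s i = t - i) (hj : s j = -j) (b : D) :
    s b + b ∈ Subring.center D ∧ s b * b ∈ Subring.center D := by
  have ht := h.t_mem_center
  have ht' := Subring.mem_center_iff.1 ht
  have hn := Subring.mem_center_iff.2 h.n_central
  have hδ := Subring.mem_center_iff.2 h.δ_central
  obtain ⟨z₁, h₁, z₂, h₂, z₃, h₃, z₄, h₄, hb⟩ := H i j h.not_comm b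
  have h₁' := Subring.mem_center_iff.1 h₁
  have h₂' := Subring.mem_center_iff.1 h₂
  have h₃' := Subring.mem_center_iff.1 h₃
  have h₄' := Subring.mem_center_iff.1 h₄
  have hji := h.j_mul_i
  have hji' : j * (t - i) = i * j := by
    linear_combination (norm := noncomm_ring) -hji + ht' j
  have hsb : s b = z₁ + z₂ * (t - i) - (z₃ + z₄ * i) * j := by
    rw [hb]
    simp only [hs.map_add, hs.map_mul, hcen _ h₁, hcen _ h₂, hcen _ h₃, hcen _ h₄, hi, hj]
    linear_combination (norm := noncomm_ring) h₂' (t - i) - h₃' j - j * h₄' (t - i)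
      - h₄' j * (t - i)
      - z₄ * hji'
  constructor
  · have : s b + b = z₁ + z₁ + z₂ * t := by rw [hsb, hb]; noncomm_ring
    rw [this]
    exact add_mem (add_mem h₁ h₁) (mul_mem h₂ ht)
  · have hPP := mul_conj_mem_center ht hn h.i_mul_i h₁ h₂
    have hQQ := mul_conj_mem_center ht hn h.i_mul_i h₃ h₄
    have hjP : j * (z₁ + z₂ * i) = (z₁ + z₂ * (t - i)) * j := by
      linear_combination (norm := noncomm_ring) h₁' j + h₂' j * i + z₂ * hji
    have hjQ : j * (z₃ + z₄ * i) = (z₃ + z₄ * (t - i)) * j := by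
      linear_combination (norm := noncomm_ring) h₃' j + h₄' j * i + z₄ * hji
    have hti : Commute (t - i) i := Commute.sub_left (ht' i).symm (Commute.refl i)
    have hcomm : ∀ {u v : D}, u ∈ Subring.center D → v ∈ Subring.center D →
        (z₁ + z₂ * (t - i)) * (u + v * i) = (u + v * i) * (z₁ + z₂ * (t - i)) := fun hu hv =>
      commute_add_mul_of_mem_center hu hv
        (commute_add_mul_of_mem_center h₁ h₂ hti.symm).symm
    have hPP' := hcomm h₁ h₂
    have hQP := hcomm h₃ h₄
    obtain ⟨P, hP⟩ : ∃ P, P = z₁ + z₂ * i := ⟨_, rfl⟩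
    obtain ⟨P', hP'⟩ : ∃ P, P = z₁ + z₂ * (t - i) := ⟨_, rfl⟩
    obtain ⟨Q, hQ⟩ : ∃ P, P = z₃ + z₄ * i := ⟨_, rfl⟩
    obtain ⟨Q', hQ'⟩ : ∃ P, P = z₃ + z₄ * (t - i) := ⟨_, rfl⟩
    rw [← hP, ← hQ] at hb
    simp only [← hP, ← hP', ← hQ, ← hQ'] at hsb hjP hjQ hPP hQQ hPP' hQP
    have : s b * b = P * P' - Q * Q' * δ := by
      rw [hsb, hb]
      linear_combination (norm := noncomm_ring) hPP' - Q * hjQ * j - Q * hjP + hQP * j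
        - Q * Q' * h.j_mul_j
    rw [this]
    exact sub_mem hPP (mul_mem hQQ hδ)

/-- Every anti-homomorphism of a quaternion division algebra that is the identity on the center
becomes the canonical involution after composition with an inner automorphism. -/
theorem IsAntiHom.exists_conj_canonical {s : D → D} (hs : IsAntiHom s) (H : SpansOverCenter D)
    (hD : ∃ b c : D, b * c ≠ c * b) (hcen : ∀ z ∈ Subring.center D, s z = z) :
    ∃ w, w ≠ 0 ∧ ∀ b, w * s b * w⁻¹ + b ∈ Subring.center D ∧
      w * s b * w⁻¹ * b ∈ Subring.center D := by
  obtain ⟨i, j, t, n, δ, h⟩ := H.exists_isQuaternionFrame hD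
  have ht := h.t_mem_center
  have ht' := Subring.mem_center_iff.1 ht
  have hji := h.j_mul_i
  have hj0 : j ≠ 0 := by
    rintro rfl
    exact h.not_comm (by simp)
  -- An inner automorphism moves `s i` to the conjugate of `i`.
  obtain ⟨v, hv0, hv⟩ := exists_ne_zero_mul_eq_mul (p := s i) (q := t - i) ht' h.n_central
    (by
      have := congrArg s h.i_mul_i
      rw [hs.map_mul, hs.map_sub, hs.map_mul, hcen t ht,
        hcen n (Subring.mem_center_iff.2 h.n_central)] at this
      rw [this, ht'])
    (by linear_combination (norm := noncomm_ring) h.i_mul_i - ht' i)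
    ⟨j, fun hc => h.not_comm (by linear_combination (norm := noncomm_ring) hc - ht' j)⟩
  have hs₁ := hs.conj hv0
  obtain ⟨r, hr⟩ : ∃ r, r = fun d => v * s d * v⁻¹ := ⟨_, rfl⟩
  rw [← hr] at hs₁
  have hrcen : ∀ z ∈ Subring.center D, r z = z := fun z hz => by
    rw [hr]
    simp only
    rw [hcen z hz, Subring.mem_center_iff.1 hz v, mul_assoc, mul_inv_cancel₀ hv0, mul_one]
  have hri : r i = t - i := by
    rw [hr]
    simp only
    rw [hv, mul_assoc, mul_inv_cancel₀ hv0, mul_one]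
  have hrti : r (t - i) = i := by
    rw [hs₁.map_sub, hri, hrcen t ht, sub_sub_cancel]
  -- Now `r j = c * j`, where `c` commutes with `i` and has norm `c * c' = 1`.
  obtain ⟨c, hc⟩ : ∃ c, c = r j * j⁻¹ := ⟨_, rfl⟩
  have hrj : r j = c * j := by rw [hc, mul_assoc, inv_mul_cancel₀ hj0, mul_one]
  have hrel : (t - i) * (c * j) = (c * j) * i := by
    have := congrArg r hji
    rwa [hs₁.map_mul, hs₁.map_mul, hrti, hri, hrj] at this
  have hci : c * i = i * c := by
    apply mul_right_cancel₀ hj0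
    linear_combination (norm := noncomm_ring) hrel + c * hji + ht' c * j
  have hδ : c * j * (c * j) = j * j := by
    rw [← hrj, ← hs₁.map_mul, h.j_mul_j, hrcen δ (Subring.mem_center_iff.2 h.δ_central)]
  obtain ⟨c', hc'⟩ : ∃ c', c' = j * c * j⁻¹ := ⟨_, rfl⟩
  have hjc : j * c = c' * j := by rw [hc', mul_assoc, inv_mul_cancel₀ hj0, mul_one]
  have hjc' : j * c' = c * j := by
    apply mul_right_cancel₀ hj0
    have := h.δ_central c
    rw [← h.j_mul_j] at this
    linear_combination (norm := noncomm_ring) -j * hjc - this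
  have hcc : c * c' = 1 := by
    apply mul_right_cancel₀ hj0
    apply mul_right_cancel₀ hj0
    linear_combination (norm := noncomm_ring) hδ - c * hjc * j
  have hc'i : c' * i = i * c' := by
    apply mul_right_cancel₀ hj0
    have hji' : j * (t - i) = i * j := by
      linear_combination (norm := noncomm_ring) -hji + ht' j
    linear_combination (norm := noncomm_ring) -c' * hji' - hjc * (t - i) + j * ht' c - j * hci
      + hji' * c + i * hjc
  -- Hilbert 90 for the quadratic extension generated by `i`, with `z'` the conjugate of `z`.
  have hw : ∀ z z' : D, z * i = i * z → z' * i = i * z' → z * c = c * z → z' * c = c * z' →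
      j * z = z' * j → j * z' = z * j → z - c' * z' ≠ 0 →
      ∃ w, w ≠ 0 ∧ w * i = i * w ∧ w * (c * j) = -j * w := by
    intro z z' hz hz' hzc hzc' hjz hjz' hne
    refine ⟨z - c' * z', hne, ?_, ?_⟩
    · linear_combination (norm := noncomm_ring) hz - c' * hz' - hc'i * z'
    · linear_combination (norm := noncomm_ring) hzc * j - c' * hzc' * j
        - (mul_eq_one_comm.1 hcc) * z' * j + hjz - hjc' * z' - c * hjz'
  obtain ⟨w, hw0, hwi, hwj⟩ : ∃ w, w ≠ 0 ∧ w * i = i * w ∧ w * (c * j) = -j * w := by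
    by_cases hc1 : c' = 1
    · refine hw i (t - i) rfl ?_ hci.symm ?_ ?_ ?_ ?_
      · linear_combination (norm := noncomm_ring) -ht' i
      · linear_combination (norm := noncomm_ring) -ht' c + hci
      · exact hji
      · linear_combination (norm := noncomm_ring) -hji + ht' j
      · rw [hc1, one_mul, sub_ne_zero]
        intro h'
        rw [← h'] at hji
        exact h.not_comm hji.symm
    · exact hw 1 1 (by simp) (by simp) (by simp) (by simp) (by simp) (by simp)
        (by rwa [mul_one, sub_ne_zero, ne_comm])
  refine ⟨w * v, mul_ne_zero hw0 hv0, fun b => ?_⟩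
  have hfin : w * v * s b * (w * v)⁻¹ = w * r b * w⁻¹ := by
    rw [hr, mul_inv_rev]
    simp only [mul_assoc]
  rw [hfin]
  refine (hs₁.conj hw0).canonical_of_frame H (fun z hz => ?_) h ?_ ?_ b
  · rw [hrcen z hz, Subring.mem_center_iff.1 hz w, mul_assoc, mul_inv_cancel₀ hw0, mul_one]
  · have : w * (t - i) = (t - i) * w := by
      linear_combination (norm := noncomm_ring) ht' w - hwi
    rw [hri, this, mul_assoc, mul_inv_cancel₀ hw0, mul_one]
  · rw [hrj, hwj, mul_assoc, mul_inv_cancel₀ hw0, mul_one]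

end AntiHom

/-! ### Decompositions along a separable quadratic element -/

section Quadratic

variable {D : Type*} [DivisionRing D]

/-- `p` is a root of the separable polynomial `X ^ 2 - t X + n` with central coefficients. -/
structure IsSeparableQuadratic (p t n : D) : Prop where
  t_central : ∀ d, d * t = t * d
  n_central : ∀ d, d * n = n * d
  mul_self : p * p = t * p - n
  ne_conj : t - p ≠ p

namespace IsSeparableQuadratic

variable {p t n y : D}

theorem commute_sub (h : IsSeparableQuadratic p t n) {b : D} (hb : b * p = p * b) :
    b * (t - p) = (t - p) * b := by
  linear_combination (norm := noncomm_ring) h.t_central b - hb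

theorem mul_sub_eq (h : IsSeparableQuadratic p t n) (hy : y * p = (t - p) * y) :
    y * (t - p) = p * y := by
  linear_combination (norm := noncomm_ring) h.t_central y - hy

theorem inv_mul_eq (h : IsSeparableQuadratic p t n) (hy0 : y ≠ 0) (hy : y * p = (t - p) * y) :
    y⁻¹ * p = (t - p) * y⁻¹ := by
  apply mul_right_cancel₀ hy0
  have h1 : y⁻¹ * y = 1 := inv_mul_cancel₀ hy0
  linear_combination (norm := noncomm_ring) -y⁻¹ * h.mul_sub_eq hy + h1 * (t - p) - (t - p) * h1

theorem conj_commute (h : IsSeparableQuadratic p t n) (hy0 : y ≠ 0) (hy : y * p = (t - p) * y)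
    {b : D} (hb : b * p = p * b) : (y * b * y⁻¹) * p = p * (y * b * y⁻¹) := by
  linear_combination (norm := noncomm_ring) y * b * h.inv_mul_eq hy0 hy + y * h.commute_sub hb * y⁻¹
    + h.mul_sub_eq hy * b * y⁻¹

theorem mul_commute (h : IsSeparableQuadratic p t n) {v : D} (hv : v * p = (t - p) * v)
    (hy : y * p = (t - p) * y) : v * y * p = p * (v * y) := by
  linear_combination (norm := noncomm_ring) v * hy + h.mul_sub_eq hv * y

theorem inv_sub_commute (h : IsSeparableQuadratic p t n) {b : D} (hb : b * p = p * b) :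
    b * (p - (t - p))⁻¹ = (p - (t - p))⁻¹ * b :=
  (Commute.inv_right₀ (show Commute b (p - (t - p)) from
    Commute.sub_right hb (h.commute_sub hb))).eq

theorem sub_ne_zero (h : IsSeparableQuadratic p t n) : p - (t - p) ≠ 0 :=
  _root_.sub_ne_zero.2 h.ne_conj.symm

/-- If `C` is the centralizer of `p` and `y` conjugates `p` to `t - p`, then `D = C + C y`. -/
theorem exists_eq_add_mul (h : IsSeparableQuadratic p t n) (hy0 : y ≠ 0)
    (hy : y * p = (t - p) * y) (z : D) :
    ∃ a b, a * p = p * a ∧ b * p = p * b ∧ z = a + b * y := by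
  obtain ⟨e, he⟩ : ∃ e, e = (p - (t - p))⁻¹ := ⟨_, rfl⟩
  have hep : e * p = p * e := by rw [he]; exact (h.inv_sub_commute rfl).symm
  have he1 : e * (p - (t - p)) = 1 := by rw [he]; exact inv_mul_cancel₀ h.sub_ne_zero
  obtain ⟨v, hv⟩ : ∃ v, v = p * z - z * p := ⟨_, rfl⟩
  have hvp : v * p = (t - p) * v := by
    rw [hv]
    exact mul_conj_eq_mul_sub h.t_central h.n_central h.mul_self z
  have hy1 : y⁻¹ * y = 1 := inv_mul_cancel₀ hy0
  refine ⟨e * (z * p - (t - p) * z), e * (v * y⁻¹), ?_, ?_, ?_⟩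
  · linear_combination (norm := noncomm_ring) e * z * h.mul_self - e * h.mul_self * z
      + e * h.t_central z * p - e * h.n_central z + e * h.t_central p * z
      + hep * (z * p - (t - p) * z)
  · linear_combination (norm := noncomm_ring) e * v * h.inv_mul_eq hy0 hy
      + e * h.mul_sub_eq hvp * y⁻¹ + hep * v * y⁻¹
  · rw [hv]
    linear_combination (norm := noncomm_ring) -he1 * z - e * (p * z - z * p) * hy1

theorem eq_zero_of_add_mul_eq_zero (h : IsSeparableQuadratic p t n) (hy0 : y ≠ 0)
    (hy : y * p = (t - p) * y) {a b : D} (ha : a * p = p * a) (hb : b * p = p * b)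
    (hab : a + b * y = 0) : a = 0 ∧ b = 0 := by
  have h1 : (p - (t - p)) * b * y = 0 := by
    linear_combination (norm := noncomm_ring) p * hab - hab * p + ha + b * hy + h.commute_sub hb * y
  have hb0 : b = 0 := by simpa [hy0, h.sub_ne_zero] using h1
  exact ⟨by simpa [hb0] using hab, hb0⟩

/-- An element of the centralizer `C` of `p` that commutes with `y ^ 2` lies in `C₀ + p C₀`, where
`C₀` is the subring of `C` fixed by conjugation by `y`. -/
theorem exists_eq_add_mul_of_commute (h : IsSeparableQuadratic p t n) (hy0 : y ≠ 0)
    (hy : y * p = (t - p) * y) {b : D} (hb : b * p = p * b) (hyb : b * (y * y) = (y * y) * b) :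
    ∃ q r, q * p = p * q ∧ q * y = y * q ∧ r * p = p * r ∧ r * y = y * r ∧ b = q + p * r := by
  obtain ⟨e, he⟩ : ∃ e, e = (p - (t - p))⁻¹ := ⟨_, rfl⟩
  have hep : ∀ {b}, b * p = p * b → b * e = e * b := fun hb => by
    rw [he]
    exact h.inv_sub_commute hb
  have he1 : e * (p - (t - p)) = 1 := by rw [he]; exact inv_mul_cancel₀ h.sub_ne_zero
  have he2 : (p - (t - p)) * e = 1 := by rw [he]; exact mul_inv_cancel₀ h.sub_ne_zero
  have hye : y * e = - e * y := by
    have : y * (p - (t - p)) = - (p - (t - p)) * y := by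
      linear_combination (norm := noncomm_ring) hy - h.mul_sub_eq hy
    linear_combination (norm := noncomm_ring) e * this * e - e * y * he2 - he1 * y * e
  obtain ⟨b', hb'⟩ : ∃ b', b' = y * b * y⁻¹ := ⟨_, rfl⟩
  have hb'p : b' * p = p * b' := by rw [hb']; exact h.conj_commute hy0 hy hb
  have hb'y : b' * y = y * b := by rw [hb', mul_assoc, inv_mul_cancel₀ hy0, mul_one]
  have hyb' : y * b' = b * y := by
    apply mul_right_cancel₀ hy0
    linear_combination (norm := noncomm_ring) y * hb'y - hyb
  have hrp : (b - b') * e * p = p * ((b - b') * e) := by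
    linear_combination (norm := noncomm_ring) -(b - b') * hep (rfl : p * p = p * p)
      + hb * e - hb'p * e
  have hry : (b - b') * e * y = y * ((b - b') * e) := by
    linear_combination (norm := noncomm_ring) (b - b') * hye + hb'y * e + hyb' * e
  refine ⟨b - p * ((b - b') * e), (b - b') * e, ?_, ?_, hrp, hry, by noncomm_ring⟩
  · linear_combination (norm := noncomm_ring) hb - p * hrp
  · obtain ⟨r, hr⟩ : ∃ r, r = (b - b') * e := ⟨_, rfl⟩
    have hrd : r * (p - (t - p)) = b - b' := by rw [hr, mul_assoc, he1, mul_one]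
    rw [← hr] at hrp hry ⊢
    linear_combination (norm := noncomm_ring) hy * r - p * hry + hb'y + (p - (t - p)) * hry
      - hrd * y - h.commute_sub hrp * y + hrp * y

theorem eq_zero_of_add_mul_eq_zero_of_commute (h : IsSeparableQuadratic p t n) (hy0 : y ≠ 0)
    (hy : y * p = (t - p) * y) {q r : D} (hq : q * y = y * q) (hr : r * y = y * r)
    (hqr : q + p * r = 0) : q = 0 ∧ r = 0 := by
  have h1 : (p - (t - p)) * r * y = 0 := by
    linear_combination (norm := noncomm_ring) hqr * y - y * hqr - hq + hy * r - (t - p) * hr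
  have hr0 : r = 0 := by simpa [hy0, h.sub_ne_zero] using h1
  exact ⟨by simpa [hr0] using hqr, hr0⟩

end IsSeparableQuadratic

end Quadratic

/-! ### Centralizers of a separable quadratic element -/

section Centralizer

variable {F A : Type*} [Field F] [DivisionRing A] [Algebra F A]

theorem mem_centralizer_singleton {p b : A} :
    b ∈ Subalgebra.centralizer F {p} ↔ b * p = p * b := by
  simp [Subalgebra.mem_centralizer_iff, eq_comm]

theorem mem_centralizer_pair {p y b : A} :
    b ∈ Subalgebra.centralizer F {p, y} ↔ b * p = p * b ∧ b * y = y * b := by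
  simp only [Subalgebra.mem_centralizer_iff, Set.mem_insert_iff, Set.mem_singleton_iff,
    forall_eq_or_imp, forall_eq]
  exact and_congr eq_comm eq_comm

namespace IsSeparableQuadratic

variable {p t n y : A}

theorem exists_conjugator (h : IsSeparableQuadratic p t n) (hp : ∃ d, d * p ≠ p * d) :
    ∃ y, y ≠ 0 ∧ y * p = (t - p) * y := by
  obtain ⟨z, hz⟩ := hp
  exact ⟨p * z - z * p, _root_.sub_ne_zero.2 hz.symm,
    mul_conj_eq_mul_sub h.t_central h.n_central h.mul_self z⟩

variable (F) in
theorem two_mul_finrank_centralizer (h : IsSeparableQuadratic p t n) (hy0 : y ≠ 0)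
    (hy : y * p = (t - p) * y) [FiniteDimensional F A] :
    2 * Module.finrank F (Subalgebra.centralizer F {p}) = Module.finrank F A := by
  let B := Subalgebra.centralizer F {p}
  let f : B × B →ₗ[F] A :=
    B.val.toLinearMap.coprod ((LinearMap.mulRight F y).comp B.val.toLinearMap)
  have hbij : Function.Bijective f := by
    constructor
    · rw [← LinearMap.ker_eq_bot, LinearMap.ker_eq_bot']
      rintro ⟨⟨a, ha⟩, ⟨b, hb⟩⟩ hab
      have := h.eq_zero_of_add_mul_eq_zero hy0 hy (mem_centralizer_singleton.1 ha)
        (mem_centralizer_singleton.1 hb) hab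
      simp only [this.1, this.2]
      rfl
    · intro z
      obtain ⟨a, b, ha, hb, rfl⟩ := h.exists_eq_add_mul hy0 hy z
      exact ⟨⟨⟨a, mem_centralizer_singleton.2 ha⟩, ⟨b, mem_centralizer_singleton.2 hb⟩⟩, rfl⟩
  rw [← (LinearEquiv.ofBijective f hbij).finrank_eq, Module.finrank_prod, two_mul]

variable (F) in
theorem two_mul_finrank_centralizer_pair (h : IsSeparableQuadratic p t n) (hy0 : y ≠ 0)
    (hy : y * p = (t - p) * y) (hyy : ∀ b, b * p = p * b → b * (y * y) = (y * y) * b)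
    [FiniteDimensional F A] :
    2 * Module.finrank F (Subalgebra.centralizer F {p, y}) =
      Module.finrank F (Subalgebra.centralizer F {p}) := by
  let B := Subalgebra.centralizer F {p}
  let Q := Subalgebra.centralizer F {p, y}
  have hQB : Q ≤ B := fun q hq => mem_centralizer_singleton.2 (mem_centralizer_pair.1 hq).1
  let p' : B := ⟨p, mem_centralizer_singleton.2 rfl⟩
  let g : Q →ₗ[F] B := (Subalgebra.inclusion hQB).toLinearMap
  let f : Q × Q →ₗ[F] B := g.coprod ((LinearMap.mulLeft F p').comp g)
  have hbij : Function.Bijective f := by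
    constructor
    · rw [← LinearMap.ker_eq_bot, LinearMap.ker_eq_bot']
      rintro ⟨⟨a, ha⟩, ⟨b, hb⟩⟩ hab
      have := h.eq_zero_of_add_mul_eq_zero_of_commute hy0 hy (mem_centralizer_pair.1 ha).2
        (mem_centralizer_pair.1 hb).2 (congrArg Subtype.val hab)
      simp only [this.1, this.2]
      rfl
    · rintro ⟨z, hz⟩
      have hz' := mem_centralizer_singleton.1 hz
      obtain ⟨q, r, hqp, hqy, hrp, hry, hqr⟩ :=
        h.exists_eq_add_mul_of_commute hy0 hy hz' (hyy z hz')
      exact ⟨⟨⟨q, mem_centralizer_pair.2 ⟨hqp, hqy⟩⟩, ⟨r, mem_centralizer_pair.2 ⟨hrp, hry⟩⟩⟩,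
        Subtype.ext hqr.symm⟩
  rw [← (LinearEquiv.ofBijective f hbij).finrank_eq, Module.finrank_prod, two_mul]

/-- The centralizer of `p` and the element `y` together generate `A`. -/
theorem commute_all_of_commute (h : IsSeparableQuadratic p t n) (hy0 : y ≠ 0)
    (hy : y * p = (t - p) * y) {z : A} (hzB : ∀ b, b * p = p * b → b * z = z * b)
    (hzy : y * z = z * y) (d : A) : d * z = z * d := by
  obtain ⟨a, b, ha, hb, rfl⟩ := h.exists_eq_add_mul hy0 hy d
  linear_combination (norm := noncomm_ring) hzB a ha + hzB b hb * y + b * hzy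

/-- The centralizer of `p` is not commutative as soon as `A` has more than four dimensions: if it
were, the elements fixed by conjugation by `y` would be central in `A`. -/
theorem exists_not_commute (h : IsSeparableQuadratic p t n) (hy0 : y ≠ 0)
    (hy : y * p = (t - p) * y) [FiniteDimensional F A] (hfr : 4 < Module.finrank F A)
    (hcen : ∀ z : A, (∀ d, d * z = z * d) → ∃ c, z = algebraMap F A c) :
    ∃ b c : A, b * p = p * b ∧ c * p = p * c ∧ b * c ≠ c * b := by
  by_contra! hB
  have hyyp : y * y * p = p * (y * y) := h.mul_commute hy hy
  have h1 := h.two_mul_finrank_centralizer F hy0 hy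
  have h2 := h.two_mul_finrank_centralizer_pair F hy0 hy (fun b hb => hB b _ hb hyyp)
  have h3 : Subalgebra.centralizer F {p, y} ≤ ⊥ := by
    intro z hz
    rw [mem_centralizer_pair] at hz
    obtain ⟨c, rfl⟩ := hcen z
      (h.commute_all_of_commute hy0 hy (fun b hb => hB b z hb hz.1) hz.2.symm)
    exact (⊥ : Subalgebra F A).algebraMap_mem c
  rw [le_bot_iff.1 h3, Subalgebra.finrank_bot] at h2
  omega

end IsSeparableQuadratic

end Centralizer

/-! ### The centralizer of a separable quadratic element in degree four -/

section DegreeFour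

variable {F A : Type*} [Field F] [DivisionRing A] [Algebra F A]

/-- The centralizer `B` of `p` in an algebra of degree four is a quaternion algebra over its center
`F + F p`. -/
theorem spansOverCenter_centralizer [FiniteDimensional F A] (hfr : Module.finrank F A = 16)
    (hcen : ∀ z : A, (∀ d, d * z = z * d) → ∃ c, z = algebraMap F A c) {p t n : A}
    (h : IsSeparableQuadratic p t n) (hp : ∃ d, d * p ≠ p * d) :
    letI := divisionRingOfFiniteDimensional F (Subalgebra.centralizer F {p})
    SpansOverCenter (Subalgebra.centralizer F {p}) ∧
      (∃ b c : Subalgebra.centralizer F {p}, b * c ≠ c * b) ∧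
      ∀ z ∈ Subring.center (Subalgebra.centralizer F {p}),
        ∃ c d : F, (z : A) = algebraMap F A c + algebraMap F A d * p := by
  let _ := divisionRingOfFiniteDimensional F (Subalgebra.centralizer F {p})
  let B := Subalgebra.centralizer F {p}
  obtain ⟨y, hy0, hy⟩ := h.exists_conjugator hp
  have h8 := h.two_mul_finrank_centralizer F hy0 hy
  obtain ⟨b, c, hb, hc, hbc⟩ := h.exists_not_commute hy0 hy (F := F) (by omega) hcen
  have hB : ∃ b c : B, b * c ≠ c * b :=
    ⟨⟨b, mem_centralizer_singleton.2 hb⟩, ⟨c, mem_centralizer_singleton.2 hc⟩,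
      fun hbc' => hbc (congrArg Subtype.val hbc')⟩
  have hle := four_mul_finrank_center_le (F := F) hB
  let p' : B := ⟨p, mem_centralizer_singleton.2 rfl⟩
  have hp' : p' ∈ Subalgebra.center F B := Subalgebra.mem_center_iff.2 fun b =>
    Subtype.ext (mem_centralizer_singleton.1 b.2)
  let f : F × F →ₗ[F] Subalgebra.center F B :=
    (LinearMap.toSpanSingleton F _ 1).coprod (LinearMap.toSpanSingleton F _ ⟨p', hp'⟩)
  have hf : ∀ c : F × F, ((f c : B) : A) = algebraMap F A c.1 + algebraMap F A c.2 * p := by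
    intro c
    simp [f, p', Algebra.smul_def]
  have hinj : Function.Injective f := by
    rw [← LinearMap.ker_eq_bot, LinearMap.ker_eq_bot']
    rintro ⟨c, d⟩ hcd
    have h0 : algebraMap F A c + algebraMap F A d * p = 0 := by
      rw [← hf (c, d), hcd]
      rfl
    have hd : d = 0 := by
      by_contra hd
      obtain ⟨e, he⟩ := hp
      apply he
      have hpe : p = algebraMap F A (-(d⁻¹ * c)) := by
        have hd1 : algebraMap F A d⁻¹ * algebraMap F A d = 1 := by
          rw [← map_mul, inv_mul_cancel₀ hd, map_one]
        rw [map_neg, map_mul]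
        linear_combination (norm := noncomm_ring) algebraMap F A d⁻¹ * h0 - hd1 * p
      rw [hpe]
      exact (Algebra.commutes _ _).symm
    subst hd
    simpa using h0
  have hge := LinearMap.finrank_le_finrank_of_injective hinj
  rw [Module.finrank_prod, Module.finrank_self] at hge
  have hle' : 4 * Module.finrank F (Subalgebra.center F B) ≤ Module.finrank F B := hle
  have h8' : 2 * Module.finrank F B = _ := h8
  have h2 : Module.finrank F (Subalgebra.center F B) = 2 := by omega
  have hsurj := (LinearMap.injective_iff_surjective_of_finrank_eq_finrank (by
    rw [Module.finrank_prod, Module.finrank_self, h2])).1 hinj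
  have hB4 : Module.finrank F B ≤ 4 * Module.finrank F (Subalgebra.center F B) := by omega
  refine ⟨spansOverCenter_of_finrank_le hB4, hB, fun z hz => ?_⟩
  obtain ⟨c, hc⟩ := hsurj ⟨z, hz⟩
  exact ⟨c.1, c.2, by rw [← hf c, hc]⟩

end DegreeFour

/-! ### Anti-homomorphisms of an algebra of exponent two -/

section Existence

variable {F A : Type*} [Field F] [DivisionRing A] [Algebra F A]

/-- If `A ⊗ A` is the algebra of matrices acting on `V = F ^ m`, then `V` has the dimension of `A`,
so `V` is free of rank one over the first copy of `A`, on any `v ≠ 0`.  The anti-homomorphism sends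
`b` to the unique element `s b` such that `s b ⊗ 1` and `1 ⊗ b` agree on `v`. -/
theorem exists_isAntiHom_of_isSplitAlgebra [FiniteDimensional F A]
    (hsplit : IsSplitAlgebra F (A ⊗[F] A)) :
    ∃ s : A → A, IsAntiHom s ∧ ∀ c : F, s (algebraMap F A c) = algebraMap F A c := by
  obtain ⟨m, hm, ⟨φ⟩⟩ := hsplit
  have hdim : Module.finrank F A = Module.finrank F (Fin m → F) := by
    have := φ.toLinearEquiv.finrank_eq
    rw [Module.finrank_tensorProduct, Module.finrank_matrix] at this
    simpa [Nat.mul_self_inj] using this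
  have : Nonempty (Fin m) := Fin.pos_iff_nonempty.1 (Nat.pos_of_ne_zero hm)
  obtain ⟨v, hv⟩ := exists_ne (0 : Fin m → F)
  let f : A →ₗ[F] (Fin m → F) :=
    { toFun := fun a => (φ (a ⊗ₜ 1)).mulVec v
      map_add' := fun a b => by simp [TensorProduct.add_tmul, Matrix.add_mulVec]
      map_smul' := fun c a => by
        simp [← TensorProduct.smul_tmul', Matrix.smul_mulVec] }
  have hf : ∀ a, f a = (φ (a ⊗ₜ 1)).mulVec v := fun _ => rfl
  have hf_mul : ∀ a b, f (a * b) = (φ (a ⊗ₜ 1)).mulVec (f b) := fun a b => by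
    rw [hf, hf, Matrix.mulVec_mulVec, ← map_mul, Algebra.TensorProduct.tmul_mul_tmul, one_mul]
  have hinj : Function.Injective f := by
    rw [← LinearMap.ker_eq_bot, LinearMap.ker_eq_bot']
    intro a ha
    by_contra ha0
    apply hv
    have := hf_mul a⁻¹ a
    rwa [ha, inv_mul_cancel₀ ha0, Matrix.mulVec_zero, hf, ← Algebra.TensorProduct.one_def, map_one,
      Matrix.one_mulVec] at this
  have hsurj := (LinearMap.injective_iff_surjective_of_finrank_eq_finrank hdim).1 hinj
  choose g hg using hsurj
  have hgf : ∀ a, g (f a) = a := fun a => hinj (hg _)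
  refine ⟨fun b => g ((φ (1 ⊗ₜ b)).mulVec v), ⟨?_, ?_, ?_⟩, ?_⟩
  · exact hgf 1
  · intro a b
    apply hinj
    simp only [map_add, hg, TensorProduct.tmul_add, Matrix.add_mulVec]
  · intro a b
    apply hinj
    obtain ⟨d, hd⟩ : ∃ d, d = g ((φ (1 ⊗ₜ b)).mulVec v) := ⟨_, rfl⟩
    have h1 : (1 : A) ⊗ₜ[F] (a * b) = (1 ⊗ₜ a) * (1 ⊗ₜ b) := by simp
    have h2 : (d ⊗ₜ[F] (1 : A)) * (1 ⊗ₜ a) = (1 ⊗ₜ a) * (d ⊗ₜ 1) := by simp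
    rw [hg, hf_mul, hg, Matrix.mulVec_mulVec, ← hd, ← map_mul, h1, h2, map_mul, map_mul,
      ← Matrix.mulVec_mulVec, ← Matrix.mulVec_mulVec, ← hf d, hd, hg]
  · intro c
    have : (1 : A) ⊗ₜ[F] (algebraMap F A c) = (algebraMap F A c) ⊗ₜ 1 := by
      rw [Algebra.algebraMap_eq_smul_one, TensorProduct.smul_tmul]
    simp only
    rw [this, ← hf, hgf]

/-- `s` is an anti-homomorphism of `A` that restricts to the canonical involution of the centralizer
of `p`: traces `s b + b` and norms `s b * b` lie in the center of the centralizer, and `s` fixes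
this center.  The center of the centralizer is expressed as the double centralizer of `p`. -/
structure IsCanonicalOn (F : Type*) {A : Type*} [Field F] [DivisionRing A] [Algebra F A]
    (p : A) (s : A → A) : Prop extends IsAntiHom s where
  map_double : ∀ z ∈ Subalgebra.centralizer F (Subalgebra.centralizer F {p} : Set A), s z = z
  add_mem : ∀ b ∈ Subalgebra.centralizer F {p},
    s b + b ∈ Subalgebra.centralizer F (Subalgebra.centralizer F {p} : Set A)
  mul_mem : ∀ b ∈ Subalgebra.centralizer F {p},
    s b * b ∈ Subalgebra.centralizer F (Subalgebra.centralizer F {p} : Set A)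

theorem mem_double_centralizer {p z : A} :
    z ∈ Subalgebra.centralizer F (Subalgebra.centralizer F {p} : Set A) ↔
      ∀ b, b * p = p * b → b * z = z * b := by
  rw [Subalgebra.mem_centralizer_iff]
  exact forall_congr' fun b => by rw [SetLike.mem_coe, mem_centralizer_singleton]

theorem exists_isCanonicalOn [FiniteDimensional F A] (hfr : Module.finrank F A = 16)
    (hcen : ∀ z : A, (∀ d, d * z = z * d) → ∃ c, z = algebraMap F A c) {p : A} {t n : F}
    (h : IsSeparableQuadratic p (algebraMap F A t) (algebraMap F A n)) (hp : ∃ d, d * p ≠ p * d)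
    {s : A → A} (hs : IsAntiHom s) (hsF : ∀ c : F, s (algebraMap F A c) = algebraMap F A c) :
    ∃ s : A → A, IsCanonicalOn F p s := by
  let _ := divisionRingOfFiniteDimensional F (Subalgebra.centralizer F {p})
  let B := Subalgebra.centralizer F {p}
  obtain ⟨HB, hB, hBcen⟩ := spansOverCenter_centralizer hfr hcen h hp
  obtain ⟨w, hw0, hw⟩ := exists_ne_zero_mul_eq_mul (p := s p) h.t_central h.n_central
    (by
      have := congrArg s h.mul_self
      rwa [hs.map_mul, hs.map_sub, hs.map_mul, hsF, hsF, h.t_central] at this) h.mul_self hp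
  have hr := hs.conj hw0
  obtain ⟨r, hrdef⟩ : ∃ r, r = fun d => w * s d * w⁻¹ := ⟨_, rfl⟩
  rw [← hrdef] at hr
  have hrF : ∀ c : F, r (algebraMap F A c) = algebraMap F A c := fun c => by
    rw [hrdef]
    simp only
    rw [hsF, ← Algebra.commutes, mul_assoc, mul_inv_cancel₀ hw0, mul_one]
  have hrp : r p = p := by
    rw [hrdef]
    simp only
    rw [hw, mul_assoc, mul_inv_cancel₀ hw0, mul_one]
  have hrB : ∀ b : B, r b ∈ B := fun b => by
    have := mem_centralizer_singleton.1 b.2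
    rw [mem_centralizer_singleton]
    have := congrArg r this
    rw [hr.map_mul, hr.map_mul, hrp] at this
    exact this.symm
  let rB : B → B := fun b => ⟨r b, hrB b⟩
  have hrB' : IsAntiHom rB :=
    ⟨Subtype.ext hr.map_one, fun a b => Subtype.ext (hr.map_add a b),
      fun a b => Subtype.ext (hr.map_mul a b)⟩
  have hrL : ∀ z : B, z ∈ Subring.center B → r z = z := fun z hz => by
    obtain ⟨c, d, hcd⟩ := hBcen z hz
    rw [hcd, hr.map_add, hr.map_mul, hrF, hrF, hrp, Algebra.commutes]
  obtain ⟨v, hv0, hv⟩ := hrB'.exists_conj_canonical HB hB (fun z hz => Subtype.ext (hrL z hz))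
  have hv0' : (v : A) ≠ 0 := fun h0 => hv0 (Subtype.ext h0)
  have hvinv : ((v⁻¹ : B) : A) = (v : A)⁻¹ :=
    eq_inv_of_mul_eq_one_left (congrArg Subtype.val (inv_mul_cancel₀ hv0))
  have hL : ∀ z : B, z ∈ Subring.center B →
      (z : A) ∈ Subalgebra.centralizer F (Subalgebra.centralizer F {p} : Set A) := fun z hz =>
    mem_double_centralizer.2 fun b hb => congrArg Subtype.val
      (Subring.mem_center_iff.1 hz ⟨b, mem_centralizer_singleton.2 hb⟩)
  refine ⟨fun d => v * r d * (v : A)⁻¹, ⟨hr.conj hv0', ?_, ?_, ?_⟩⟩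
  · intro z hz
    rw [mem_double_centralizer] at hz
    have hzB : z ∈ B := mem_centralizer_singleton.2 (hz p rfl).symm
    have := hrL ⟨z, hzB⟩ (Subring.mem_center_iff.2 fun b =>
      Subtype.ext (hz b (mem_centralizer_singleton.1 b.2)))
    simp only at this ⊢
    rw [this, hz v (mem_centralizer_singleton.1 v.2), mul_assoc, mul_inv_cancel₀ hv0', mul_one]
  · intro b hb
    rw [← hvinv]
    exact hL _ (hv ⟨b, hb⟩).1
  · intro b hb
    rw [← hvinv]
    exact hL _ (hv ⟨b, hb⟩).2

end Existence

/-! ### Elements with central square -/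

section Square

variable {F A : Type*} [Field F] [DivisionRing A] [Algebra F A] {p t n u : A} {s : A → A}

theorem IsAntiHom.map_ne_zero (hs : IsAntiHom s) (hu0 : u ≠ 0) : s u ≠ 0 := fun h0 => by
  have := hs.map_mul u u⁻¹
  rw [mul_inv_cancel₀ hu0, hs.map_one, h0, mul_zero] at this
  exact one_ne_zero this

theorem IsCanonicalOn.map_self (hs : IsCanonicalOn F p s) : s p = p :=
  hs.map_double p (mem_double_centralizer.2 fun _ hb => hb)

/-- Conjugation by `u` preserves the center of the centralizer of `p`. -/
theorem IsSeparableQuadratic.conj_mem_double (h : IsSeparableQuadratic p t n) (hu0 : u ≠ 0)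
    (hu : u * p = (t - p) * u) {z : A}
    (hz : z ∈ Subalgebra.centralizer F (Subalgebra.centralizer F {p} : Set A)) :
    u * z * u⁻¹ ∈ Subalgebra.centralizer F (Subalgebra.centralizer F {p} : Set A) := by
  rw [mem_double_centralizer] at hz ⊢
  intro b hb
  have h1 : u⁻¹ * u = 1 := inv_mul_cancel₀ hu0
  have h2 : u * u⁻¹ = 1 := mul_inv_cancel₀ hu0
  have hb' := h.conj_commute (inv_ne_zero hu0) (h.inv_mul_eq hu0 hu) hb
  rw [inv_inv] at hb'
  linear_combination (norm := noncomm_ring) u * hz _ hb' * u⁻¹ - h2 * b * u * z * u⁻¹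
    + u * z * u⁻¹ * b * h2

/-- The canonical involution commutes with conjugation by `u`, since traces and norms determine it:
the difference `d` of the two sides is central in the centralizer of `p`, and so is its product
with `u b u⁻¹`; hence either `d = 0` or `u b u⁻¹` is itself central there. -/
theorem IsCanonicalOn.map_conj (hs : IsCanonicalOn F p s) (h : IsSeparableQuadratic p t n)
    (hu0 : u ≠ 0) (hu : u * p = (t - p) * u) {b : A} (hb : b * p = p * b) :
    s (u * b * u⁻¹) = u * s b * u⁻¹ := by
  have hb' := h.conj_commute hu0 hu hb
  obtain ⟨b', hb'def⟩ : ∃ b', b' = u * b * u⁻¹ := ⟨_, rfl⟩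
  rw [← hb'def] at hb' ⊢
  have h1 : u⁻¹ * u = 1 := inv_mul_cancel₀ hu0
  obtain ⟨L, hL⟩ : ∃ L, L = Subalgebra.centralizer F (Subalgebra.centralizer F {p} : Set A) :=
    ⟨_, rfl⟩
  have hd : s b' - u * s b * u⁻¹ ∈ L := by
    have h2 := sub_mem (hs.add_mem b' (mem_centralizer_singleton.2 hb'))
      (h.conj_mem_double hu0 hu (hs.add_mem b (mem_centralizer_singleton.2 hb)))
    rw [hL]
    convert h2 using 1
    rw [hb'def]
    noncomm_ring
  have hdb : (s b' - u * s b * u⁻¹) * b' ∈ L := by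
    have h2 := sub_mem (hs.mul_mem b' (mem_centralizer_singleton.2 hb'))
      (h.conj_mem_double hu0 hu (hs.mul_mem b (mem_centralizer_singleton.2 hb)))
    rw [hL]
    convert h2 using 1
    rw [hb'def]
    linear_combination (norm := noncomm_ring) - u * s b * h1 * b * u⁻¹
  rw [← sub_eq_zero]
  by_contra hne
  have hb'L : b' ∈ L := by
    rw [hL, mem_double_centralizer] at hd hdb ⊢
    intro a ha
    apply mul_left_cancel₀ hne
    linear_combination (norm := noncomm_ring) hdb a ha - hd a ha * b'
  have hbL : b ∈ L := by
    rw [hL] at hb'L ⊢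
    have := h.conj_mem_double (inv_ne_zero hu0) (h.inv_mul_eq hu0 hu) hb'L
    convert this using 1
    rw [hb'def, inv_inv]
    linear_combination (norm := noncomm_ring) -h1 * b * u⁻¹ * u - b * h1
  rw [hL] at hbL hb'L
  apply hne
  rw [hs.map_double _ hbL, hs.map_double _ hb'L, hb'def, sub_self]

/-- If `u` conjugates `p` to `t - p`, then `s u * u` is central in the centralizer of `p`, because
`s` commutes there with conjugation by `u`. -/
theorem IsCanonicalOn.map_mul_self_mem (hs : IsCanonicalOn F p s) (h : IsSeparableQuadratic p t n)
    (hu0 : u ≠ 0) (hu : u * p = (t - p) * u) :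
    s u * u ∈ Subalgebra.centralizer F (Subalgebra.centralizer F {p} : Set A) := by
  rw [mem_double_centralizer]
  have key : ∀ b, b * p = p * b → s b * (s u * u) = s u * u * s b := by
    intro b hb
    have h1 := hs.map_conj h hu0 hu hb
    have h2 : s (u * b * u⁻¹) * u = u * s b := by
      rw [h1, mul_assoc, inv_mul_cancel₀ hu0, mul_one]
    have h3 : s u * s (u * b * u⁻¹) = s b * s u := by
      rw [← hs.map_mul, ← hs.map_mul, mul_assoc, inv_mul_cancel₀ hu0, mul_one]
    linear_combination (norm := noncomm_ring) s u * h2 - h3 * u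
  intro b hb
  have hz := hs.add_mem b (mem_centralizer_singleton.2 hb)
  have hz1 := hs.map_double _ hz
  have hz2 := mem_double_centralizer.1 hz p rfl
  have hz3 := key _ hz2.symm
  rw [hz1] at hz3
  linear_combination (norm := noncomm_ring) hz3 - key b hb

/-- Since `s u * u` is fixed by `s`, the map `s` is an involution on the elements that conjugate
`p` to `t - p`.  Hence one of `u + s u` and `u` is a nonzero `y` with `s y = ± y`, and then
`y ^ 2 = ± s y * y` commutes with `y` and with the centralizer of `p`. -/
theorem IsCanonicalOn.exists_square_central (hs : IsCanonicalOn F p s)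
    (h : IsSeparableQuadratic p t n) (hst : s t = t)
    (hu0 : u ≠ 0) (hu : u * p = (t - p) * u) {x : A} (hxp : x * p = p * x) (hux : u * x = x * u) :
    ∃ y, y ≠ 0 ∧ y * p = (t - p) * y ∧ y * x = x * y ∧ ∀ d, d * (y * y) = (y * y) * d := by
  have hl := hs.map_mul_self_mem h hu0 hu
  have hsu0 := hs.map_ne_zero hu0
  have hssu : s (s u) = u := by
    have := hs.map_double _ hl
    rw [hs.map_mul] at this
    exact mul_left_cancel₀ hsu0 this
  have hsup : s u * p = (t - p) * s u := by
    have := congrArg s hu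
    rw [hs.map_mul, hs.map_mul, hs.map_sub, hst, hs.map_self] at this
    linear_combination (norm := noncomm_ring) this + h.t_central (s u)
  have hsux : s u * x = x * s u := by
    apply mul_right_cancel₀ hu0
    have := mem_double_centralizer.1 hl x hxp
    linear_combination (norm := noncomm_ring) -this - s u * hux
  have key : ∀ y, y ≠ 0 → y * p = (t - p) * y →
      y * y ∈ Subalgebra.centralizer F (Subalgebra.centralizer F {p} : Set A) →
      ∀ d, d * (y * y) = (y * y) * d := fun y hy0 hy hyy =>
    h.commute_all_of_commute hy0 hy (mem_double_centralizer.1 hyy) (mul_assoc y y y).symm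
  by_cases h0 : u + s u = 0
  · refine ⟨u, hu0, hu, hux, key u hu0 hu ?_⟩
    have := neg_mem hl
    rwa [← neg_mul, ← eq_neg_iff_add_eq_zero.2 h0] at this
  · have hyp : (u + s u) * p = (t - p) * (u + s u) := by rw [add_mul, mul_add, hu, hsup]
    refine ⟨u + s u, h0, hyp, by rw [add_mul, mul_add, hux, hsux], key _ h0 hyp ?_⟩
    have := hs.map_mul_self_mem h h0 hyp
    rwa [hs.map_add, hssu, add_comm (s u) u] at this

end Square

/-! ### The decomposition into quaternion algebras -/

section Final

variable {F A : Type*} [Field F] [DivisionRing A] [Algebra F A]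

/-- An element that conjugates `p` to `t - p` can be chosen to commute with `x`: any `y` that
conjugates `p` to `t - p` moves `x` to another root `x'` of the same quadratic polynomial in the
centralizer of `p`, and an element of this centralizer moves `x'` back. -/
theorem exists_conjugator_commute [FiniteDimensional F A] {p t n : A}
    (h : IsSeparableQuadratic p t n) (hp : ∃ d, d * p ≠ p * d) {x : A} {a b : F}
    (hx : x * x = algebraMap F A a * x - algebraMap F A b) (hxp : x * p = p * x)
    (hxc : ∃ c, c * p = p * c ∧ c * x ≠ x * c) :
    ∃ u, u ≠ 0 ∧ u * p = (t - p) * u ∧ u * x = x * u := by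
  obtain ⟨y, hy0, hy⟩ := h.exists_conjugator hp
  let _ := divisionRingOfFiniteDimensional F (Subalgebra.centralizer F {p})
  let B := Subalgebra.centralizer F {p}
  have hy1 : y⁻¹ * y = 1 := inv_mul_cancel₀ hy0
  have hy2 : y * y⁻¹ = 1 := mul_inv_cancel₀ hy0
  obtain ⟨x', hx'⟩ : ∃ x', x' = y * x * y⁻¹ := ⟨_, rfl⟩
  have hx'p : x' * p = p * x' := hx' ▸ h.conj_commute hy0 hy hxp
  have hx'y : x' * y = y * x := by rw [hx', mul_assoc, hy1, mul_one]
  have hx'x' : x' * x' = algebraMap F A a * x' - algebraMap F A b := by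
    rw [hx']
    linear_combination (norm := noncomm_ring) y * x * hy1 * x * y⁻¹ + y * hx * y⁻¹
      - Algebra.commutes a y * x * y⁻¹ + Algebra.commutes b y * y⁻¹ - algebraMap F A b * hy2
  obtain ⟨c, hcp, hcx⟩ := hxc
  obtain ⟨w, hw0, hw⟩ := exists_ne_zero_mul_eq_mul (D := B)
    (t := algebraMap F B a) (n := algebraMap F B b)
    (p := ⟨x', mem_centralizer_singleton.2 hx'p⟩) (q := ⟨x, mem_centralizer_singleton.2 hxp⟩)
    (fun d => (Algebra.commutes a d).symm) (fun d => (Algebra.commutes b d).symm)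
    (Subtype.ext hx'x') (Subtype.ext hx)
    ⟨⟨c, mem_centralizer_singleton.2 hcp⟩, fun hc => hcx (congrArg Subtype.val hc)⟩
  have hw' : (w : A) * x' = x * w := congrArg Subtype.val hw
  have hwp := mem_centralizer_singleton.1 w.2
  refine ⟨w * y, mul_ne_zero (fun h0 => hw0 (Subtype.ext h0)) hy0, ?_, ?_⟩
  · linear_combination (norm := noncomm_ring) (w : A) * hy + h.commute_sub hwp * y
  · linear_combination (norm := noncomm_ring) -(w : A) * hx'y + hw' * y

variable {p t n y : A}

theorem mem_center_of_mem_centralizer_pair (h : IsSeparableQuadratic p t n) (hy0 : y ≠ 0)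
    (hy : y * p = (t - p) * y) (hyy : ∀ d, d * (y * y) = (y * y) * d) {z : A}
    (hzp : z * p = p * z) (hzy : z * y = y * z)
    (hz : z ∈ Subalgebra.centralizer F (Subalgebra.centralizer F {p, y} : Set A)) (d : A) :
    d * z = z * d := by
  rw [Subalgebra.mem_centralizer_iff] at hz
  refine h.commute_all_of_commute hy0 hy (fun b hb => ?_) hzy.symm d
  obtain ⟨q, r, hqp, hqy, hrp, hry, rfl⟩ := h.exists_eq_add_mul_of_commute hy0 hy hb (hyy b)
  have hq := hz q (mem_centralizer_pair.2 ⟨hqp, hqy⟩)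
  have hr := hz r (mem_centralizer_pair.2 ⟨hrp, hry⟩)
  linear_combination (norm := noncomm_ring) hq + p * hr - hzp * r

/-- The centralizer of the centralizer of `p` and `y` is spanned by `1, p, y, p y`. -/
theorem finrank_centralizer_le_four (h : IsSeparableQuadratic p t n) (hy0 : y ≠ 0)
    (hy : y * p = (t - p) * y) (hyy : ∀ d, d * (y * y) = (y * y) * d)
    (hcen : ∀ z : A, (∀ d, d * z = z * d) → ∃ c, z = algebraMap F A c) :
    Module.finrank F (Subalgebra.centralizer F (Subalgebra.centralizer F {p, y} : Set A)) ≤ 4 := by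
  let Q := Subalgebra.centralizer F {p, y}
  have hpQ : ∀ c ∈ Q, c * p = p * c := fun c hc => (mem_centralizer_pair.1 hc).1
  have hyQ : ∀ c ∈ Q, c * y = y * c := fun c hc => (mem_centralizer_pair.1 hc).2
  let v : Fin 4 → A := ![1, p, y, p * y]
  have hle : Subalgebra.toSubmodule (Subalgebra.centralizer F (Q : Set A)) ≤
      Submodule.span F (Set.range v) := by
    intro z hz
    rw [Subalgebra.mem_toSubmodule, Subalgebra.mem_centralizer_iff] at hz
    obtain ⟨a, b, ha, hb, rfl⟩ := h.exists_eq_add_mul hy0 hy z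
    obtain ⟨q, r, hqp, hqy, hrp, hry, rfl⟩ := h.exists_eq_add_mul_of_commute hy0 hy ha (hyy a)
    obtain ⟨q', r', hqp', hqy', hrp', hry', rfl⟩ :=
      h.exists_eq_add_mul_of_commute hy0 hy hb (hyy b)
    have hmem : ∀ {d}, d * p = p * d → d * y = y * d → d ∈ Q := fun h₁ h₂ =>
      mem_centralizer_pair.2 ⟨h₁, h₂⟩
    have hq := hmem hqp hqy
    have hr := hmem hrp hry
    have hq' := hmem hqp' hqy'
    have hr' := hmem hrp' hry'
    have hcomm : ∀ c ∈ Q,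
        (c * q = q * c ∧ c * r = r * c) ∧ (c * q' = q' * c ∧ c * r' = r' * c) := by
      intro c hc
      have hsub : ∀ {d}, d ∈ Q → c * d - d * c ∈ Q := fun hd =>
        sub_mem (mul_mem hc hd) (mul_mem hd hc)
      have hB : ∀ {d e}, d ∈ Q → e ∈ Q → (d + p * e) * p = p * (d + p * e) := fun hd he => by
        linear_combination (norm := noncomm_ring) hpQ _ hd + p * hpQ _ he
      have h1 := h.eq_zero_of_add_mul_eq_zero hy0 hy (hB (hsub hq) (hsub hr))
        (hB (hsub hq') (hsub hr')) (by
          linear_combination (norm := noncomm_ring) hz c hc - hpQ c hc * r - hpQ c hc * r' * y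
            - (q' + p * r') * hyQ c hc)
      have h2 := h.eq_zero_of_add_mul_eq_zero_of_commute hy0 hy (hyQ _ (hsub hq)) (hyQ _ (hsub hr))
        h1.1
      have h3 := h.eq_zero_of_add_mul_eq_zero_of_commute hy0 hy (hyQ _ (hsub hq'))
        (hyQ _ (hsub hr')) h1.2
      simpa only [sub_eq_zero] using And.intro h2 h3
    have hF : ∀ {d}, d ∈ Q → (∀ c ∈ Q, c * d = d * c) → ∃ c, d = algebraMap F A c := fun hd hd' =>
      hcen _ (mem_center_of_mem_centralizer_pair (F := F) h hy0 hy hyy (hpQ _ hd) (hyQ _ hd)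
        (Subalgebra.mem_centralizer_iff F |>.2 hd'))
    obtain ⟨c₁, rfl⟩ := hF hq fun c hc => (hcomm c hc).1.1
    obtain ⟨c₂, rfl⟩ := hF hr fun c hc => (hcomm c hc).1.2
    obtain ⟨c₃, rfl⟩ := hF hq' fun c hc => (hcomm c hc).2.1
    obtain ⟨c₄, rfl⟩ := hF hr' fun c hc => (hcomm c hc).2.2
    have : algebraMap F A c₁ + p * algebraMap F A c₂ +
        (algebraMap F A c₃ + p * algebraMap F A c₄) * y =
        c₁ • v 0 + c₂ • v 1 + c₃ • v 2 + c₄ • v 3 := by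
      simp only [v, Algebra.smul_def, ← Algebra.commutes c₂ p, ← Algebra.commutes c₄ p]
      simp [mul_assoc, add_mul, add_assoc]
    rw [this]
    have hv : ∀ i, v i ∈ Submodule.span F (Set.range v) := fun i => Submodule.subset_span ⟨i, rfl⟩
    exact add_mem (add_mem (add_mem (Submodule.smul_mem _ _ (hv 0)) (Submodule.smul_mem _ _ (hv 1)))
      (Submodule.smul_mem _ _ (hv 2))) (Submodule.smul_mem _ _ (hv 3))
  have : FiniteDimensional F (Submodule.span F (Set.range v)) :=
    FiniteDimensional.span_of_finite F (Set.finite_range v)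
  calc _ ≤ Module.finrank F (Submodule.span F (Set.range v)) := Submodule.finrank_mono hle
    _ ≤ 4 := (finrank_range_le_card v).trans (by simp)

/-- If `y` conjugates `p` to `t - p` and has central square, then `A` is the tensor product of the
centralizer of `p` and `y` and of its own centralizer. -/
theorem quaternion_decomposition [FiniteDimensional F A] (hfr : Module.finrank F A = 16)
    (h : IsSeparableQuadratic p t n) (hy0 : y ≠ 0)
    (hy : y * p = (t - p) * y) (hyy : ∀ d, d * (y * y) = (y * y) * d)
    (hcen : ∀ z : A, (∀ d, d * z = z * d) → ∃ c, z = algebraMap F A c) :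
    IsQuaternionAlgebra F (Subalgebra.centralizer F {p, y}) ∧
    IsQuaternionAlgebra F (Subalgebra.centralizer F (Subalgebra.centralizer F {p, y} : Set A)) ∧
    IsInternalTensorProduct (Subalgebra.centralizer F {p, y})
      (Subalgebra.centralizer F (Subalgebra.centralizer F {p, y} : Set A)) := by
  obtain ⟨Q₁, hQ₁⟩ : ∃ Q, Q = Subalgebra.centralizer F {p, y} := ⟨_, rfl⟩
  obtain ⟨Q₂, hQ₂⟩ : ∃ Q, Q = Subalgebra.centralizer F (Q₁ : Set A) := ⟨_, rfl⟩
  have h1 := h.two_mul_finrank_centralizer F hy0 hy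
  have h2 := h.two_mul_finrank_centralizer_pair F hy0 hy fun b _ => hyy b
  have h3 := finrank_centralizer_le_four (F := F) h hy0 hy hyy hcen
  have hcenter : ∀ z ∈ Q₁, z ∈ Q₂ → ∃ c, z = algebraMap F A c := fun z hz₁ hz₂ => by
    rw [hQ₂, hQ₁] at hz₂
    rw [hQ₁, mem_centralizer_pair] at hz₁
    exact hcen z (mem_center_of_mem_centralizer_pair h hy0 hy hyy hz₁.1 hz₁.2 hz₂)
  rw [← hQ₁] at h2 h3 ⊢
  rw [← hQ₂] at h3 ⊢
  have hcomm : ∀ (a : Q₁) (b : Q₂), (a : A) * b = b * a := fun a ⟨b, hb⟩ => by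
    rw [hQ₂, Subalgebra.mem_centralizer_iff] at hb
    exact hb a a.2
  have hp₂ : p ∈ Q₂ := by
    rw [hQ₂, Subalgebra.mem_centralizer_iff]
    exact fun g hg => (mem_centralizer_pair.1 (hQ₁ ▸ hg)).1
  have hy₂ : y ∈ Q₂ := by
    rw [hQ₂, Subalgebra.mem_centralizer_iff]
    exact fun g hg => (mem_centralizer_pair.1 (hQ₁ ▸ hg)).2
  let f : Q₁ ⊗[F] Q₂ →ₐ[F] A := Algebra.TensorProduct.lift Q₁.val Q₂.val hcomm
  have hf : ∀ (a : Q₁) (b : Q₂), f (a ⊗ₜ b) = a * b :=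
    Algebra.TensorProduct.lift_tmul Q₁.val Q₂.val hcomm
  have hsurj : Function.Surjective f := by
    intro z
    obtain ⟨a, b, ha, hb, rfl⟩ := h.exists_eq_add_mul hy0 hy z
    obtain ⟨q, r, hqp, hqy, hrp, hry, rfl⟩ := h.exists_eq_add_mul_of_commute hy0 hy ha (hyy a)
    obtain ⟨q', r', hqp', hqy', hrp', hry', rfl⟩ :=
      h.exists_eq_add_mul_of_commute hy0 hy hb (hyy b)
    have hmem : ∀ {d}, d * p = p * d → d * y = y * d → d ∈ Q₁ := fun h₁ h₂ => by
      rw [hQ₁]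
      exact mem_centralizer_pair.2 ⟨h₁, h₂⟩
    refine ⟨⟨q, hmem hqp hqy⟩ ⊗ₜ 1 + ⟨r, hmem hrp hry⟩ ⊗ₜ ⟨p, hp₂⟩ +
      ⟨q', hmem hqp' hqy'⟩ ⊗ₜ ⟨y, hy₂⟩ + ⟨r', hmem hrp' hry'⟩ ⊗ₜ (⟨p, hp₂⟩ * ⟨y, hy₂⟩), ?_⟩
    simp only [map_add, hf, OneMemClass.coe_one, MulMemClass.coe_mul]
    linear_combination (norm := noncomm_ring) hrp + hrp' * y
  have hle := LinearMap.finrank_le_finrank_of_surjective (f := f.toLinearMap) hsurj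
  rw [Module.finrank_tensorProduct] at hle
  have h4 : Module.finrank F Q₁ = 4 := by omega
  have h5 : Module.finrank F Q₂ = 4 := by
    rw [h4] at hle
    omega
  have hinj : Function.Injective f :=
    (LinearMap.injective_iff_surjective_of_finrank_eq_finrank (f := f.toLinearMap)
      (by rw [Module.finrank_tensorProduct, h4, h5, hfr])).2 hsurj
  refine ⟨?_, ?_, AlgEquiv.ofBijective f ⟨hinj, hsurj⟩, hf⟩
  · let _ := divisionRingOfFiniteDimensional F Q₁
    refine isQuaternionAlgebra_of_finrank_eq_four h4 (fun z hz => ?_) ?_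
    · obtain ⟨c, hc⟩ := hcenter z z.2 (by
        rw [hQ₂, Subalgebra.mem_centralizer_iff]
        exact fun g hg => congrArg Subtype.val (hz ⟨g, hg⟩))
      exact ⟨c, Subtype.ext hc⟩
    · by_contra! hc
      have : Q₁ ≤ ⊥ := fun z hz => by
        obtain ⟨c, rfl⟩ := hcenter z hz (by
          rw [hQ₂, Subalgebra.mem_centralizer_iff]
          exact fun g hg => congrArg Subtype.val (hc ⟨g, hg⟩ ⟨z, hz⟩))
        exact (⊥ : Subalgebra F A).algebraMap_mem c
      rw [le_bot_iff.1 this, Subalgebra.finrank_bot] at h4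
      omega
  · let _ := divisionRingOfFiniteDimensional F Q₂
    refine isQuaternionAlgebra_of_finrank_eq_four h5 (fun z hz => ?_)
      ⟨⟨y, hy₂⟩, ⟨p, hp₂⟩, fun hc => ?_⟩
    · obtain ⟨c, hc⟩ := hcenter z (by
        rw [hQ₁]
        exact mem_centralizer_pair.2 ⟨congrArg Subtype.val (hz ⟨p, hp₂⟩).symm,
          congrArg Subtype.val (hz ⟨y, hy₂⟩).symm⟩) z.2
      exact ⟨c, Subtype.ext hc⟩
    · have hc' : y * p = p * y := congrArg Subtype.val hc
      rw [hy] at hc'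
      exact h.ne_conj (mul_right_cancel₀ hy0 hc')

end Final

theorem mainTheorem8 {F A : Type*} [Field F] [DivisionRing A] [Algebra F A]
    (hdeg : IsCentralDivisionAlgebraOfDegree F A 4) (hexp : HasExponentTwo F A)
    (x x' : A) (hcomm : x * x' = x' * x)
    (hne : Algebra.adjoin F {x} ≠ Algebra.adjoin F {x'})
    (hchar2 : ringChar F = 2 →
      (IsArtinSchreier F x ∨ IsSquareCentral F x) ∧ IsArtinSchreier F x')
    (hcharNe2 : ringChar F ≠ 2 → IsSquareCentral F x ∧ IsSquareCentral F x') :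
    ∃ Q₁ Q₂ : Subalgebra F A,
      IsQuaternionAlgebra F Q₁ ∧ IsQuaternionAlgebra F Q₂ ∧
      IsInternalTensorProduct Q₁ Q₂ ∧ x ∈ Q₁ ∧ x' ∈ Q₂ := by
  have := hdeg.finite
  have hfr : Module.finrank F A = 16 := hdeg.finrank_eq
  have hcen : ∀ z : A, (∀ d, d * z = z * d) → ∃ c, z = algebraMap F A c := fun z hz => by
    obtain ⟨c, hc⟩ := Algebra.mem_bot.1 (hdeg.central.out (Subalgebra.mem_center_iff.2 hz))
    exact ⟨c, hc.symm⟩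
  have hnc : ∀ {v : A}, v ∉ Subalgebra.center F A → ∃ d, d * v ≠ v * d := fun hv => by
    rw [Subalgebra.mem_center_iff] at hv
    push Not at hv
    exact hv
  have hAS : ∀ {v : A}, IsArtinSchreier F v →
      ∃ n : F, v * v = algebraMap F A (-1) * v - algebraMap F A n := fun ⟨_, c, hc⟩ =>
    ⟨-c, by rw [map_neg, map_neg, ← hc, map_one]; noncomm_ring⟩
  have hSC : ∀ {v : A}, IsSquareCentral F v →
      ∃ n : F, v * v = algebraMap F A 0 * v - algebraMap F A n := fun ⟨_, c, _, hc⟩ =>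
    ⟨-c, by rw [map_neg, ← hc, map_zero]; noncomm_ring⟩
  have hring : ringChar F = 2 ↔ (2 : A) = 0 := ringChar_eq_two_iff
  obtain ⟨hxc, hpc, ⟨a, b, hx⟩, t, n, h⟩ : (∃ d, d * x ≠ x * d) ∧ (∃ d, d * x' ≠ x' * d) ∧
      (∃ a b : F, x * x = algebraMap F A a * x - algebraMap F A b) ∧
      ∃ t n : F, IsSeparableQuadratic x' (algebraMap F A t) (algebraMap F A n) := by
    by_cases h2 : ringChar F = 2
    · obtain ⟨hx, hx'⟩ := hchar2 h2
      obtain ⟨n, hn⟩ := hAS hx'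
      refine ⟨hnc (hx.elim (·.1) (·.1)), hnc hx'.1,
        hx.elim (fun h => ⟨_, hAS h⟩) (fun h => ⟨_, hSC h⟩), -1, n,
        fun d => (Algebra.commutes _ d).symm, fun d => (Algebra.commutes _ d).symm, hn, ?_⟩
      intro h
      have h0 : (2 : A) * x' = -1 := by
        rw [map_neg, map_one] at h
        linear_combination (norm := noncomm_ring) -h
      rw [hring.1 h2, zero_mul] at h0
      exact zero_ne_one (neg_eq_zero.1 h0.symm).symm
    · obtain ⟨hx, hx'⟩ := hcharNe2 h2
      obtain ⟨n, hn⟩ := hSC hx'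
      refine ⟨hnc hx.1, hnc hx'.1, ⟨_, hSC hx⟩, 0, n,
        fun d => (Algebra.commutes _ d).symm, fun d => (Algebra.commutes _ d).symm, hn, ?_⟩
      intro h
      have h0 : (2 : A) * x' = 0 := by
        rw [map_zero] at h
        linear_combination (norm := noncomm_ring) -h
      rcases mul_eq_zero.1 h0 with h0 | h0
      · exact h2 (hring.2 h0)
      · exact hx'.1 (h0 ▸ zero_mem _)
  obtain ⟨s, hs, hsF⟩ := exists_isAntiHom_of_isSplitAlgebra hexp.2
  obtain ⟨r, hr⟩ := exists_isCanonicalOn hfr hcen h hpc hs hsF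
  obtain ⟨u, hu0, hu, hux⟩ := exists_conjugator_commute h hpc hx hcomm (by
    by_contra! hall
    apply hne
    obtain ⟨c, d, hcd⟩ : ∃ c d : F, x = algebraMap F A c + algebraMap F A d * x' := by
      obtain ⟨_, _, hB⟩ := spansOverCenter_centralizer hfr hcen h hpc
      exact hB ⟨x, mem_centralizer_singleton.2 hcomm⟩ (Subring.mem_center_iff.2 fun b =>
        Subtype.ext (hall b (mem_centralizer_singleton.1 b.2)))
    -- Both generators lie in `F + F x'` and neither is in `F`, so each generates the other.
    have hd : d ≠ 0 := by
      rintro rfl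
      obtain ⟨e, he⟩ := hxc
      apply he
      rw [hcd, map_zero, zero_mul, add_zero]
      exact (Algebra.commutes c e).symm
    have hd' : x' = algebraMap F A d⁻¹ * (x - algebraMap F A c) := by
      have hd1 : algebraMap F A d⁻¹ * algebraMap F A d = 1 := by
        rw [← map_mul, inv_mul_cancel₀ hd, map_one]
      rw [hcd, add_sub_cancel_left, ← mul_assoc, hd1, one_mul]
    apply le_antisymm <;> rw [Algebra.adjoin_le_iff, Set.singleton_subset_iff, SetLike.mem_coe]
    · rw [hcd]
      exact add_mem (Subalgebra.algebraMap_mem _ _)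
        (mul_mem (Subalgebra.algebraMap_mem _ _) (Algebra.self_mem_adjoin_singleton F x'))
    · rw [hd']
      exact mul_mem (Subalgebra.algebraMap_mem _ _)
        (sub_mem (Algebra.self_mem_adjoin_singleton F x) (Subalgebra.algebraMap_mem _ _)))
  have hrt : r (algebraMap F A t) = algebraMap F A t :=
    hr.map_double _ (Subalgebra.algebraMap_mem _ _)
  obtain ⟨y, hy0, hy, hyx, hyy⟩ := hr.exists_square_central h hrt hu0 hu hcomm hux
  obtain ⟨hQ₁, hQ₂, hQ⟩ := quaternion_decomposition hfr h hy0 hy hyy hcen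
  refine ⟨_, _, hQ₁, hQ₂, hQ, mem_centralizer_pair.2 ⟨hcomm, hyx.symm⟩, ?_⟩
  rw [Subalgebra.mem_centralizer_iff]
  exact fun g hg => (mem_centralizer_pair.1 hg).1
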